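/- Let $\mathbb F$ be $\mathbb R$ or $\mathbb C$, let $T>0$, and let $g:\mathbb R\to\mathbb R$ be nondecreasing and left-continuous, with $g(0)=0$ and $g$ continuous at $0$. Let $\mu_g$ be the Lebesgue--Stieltjes measure with $\mu_g([c,d))=g(d)-g(c)$, let $\Delta^+g(t)=g(t^+)-g(t)$, $D_g=\{t:\Delta^+g(t)>0\}$, and let $C_g$ be the open set of points around which $g$ is constant. Let $N_g^-$ (resp. $N_g^+$) be the set of left (resp. right) endpoints of connected components of $C_g$ that do not belong to $D_g$. Assume $0\notin N_g^-$ and $T\notin N_g^+\cup D_g\cup C_g$. For $f:[0,T]\to\mathbb F$ and $t\in[0,T]$, the $g$-derivative $f'_g(t)$ is $\lim_{s\to t}\frac{f(s)-f(t)}{g(s)-g(t)}$ if $t\notin D_g\cup C_g$ (the limit being over $s\in[0,T]$ with $g(s)\ne g(t)$), $\lim_{s\to t^+}\frac{f(s)-f(t)}{g(s)-g(t)}$ if $t\in D_g$, and $\lim_{s\to b^+}\frac{f(s)-f(b)}{g(s)-g(b)}$ if $t\in C_g$ and $b$ is the right endpoint of the component of $C_g$ containing $t$. A function $f$ is $g$-continuous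 on $[0,T]$ if for all $t\in[0,T]$ and $\varepsilon>0$ there is $\delta>0$ such that $|f(t)-f(s)|<\varepsilon$ whenever $s\in[0,T]$ and $|g(t)-g(s)|<\delta$. For $k\ge 0$, $\mathcal{BC}_g^k([0,T];\mathbb F)$ is the set of functions whose iterated $g$-derivatives of orders $0,\dots,k$ exist on all of $[0,T]$ and are $g$-continuous and bounded. For $\beta:[0,T)\to\mathbb C$ $g$-integrable with $1+\beta\,\Delta^+g\neq 0$ on $[0,T)\cap D_g$, put $$\exp_g(\beta;0,t)=\exp\Big(\int_{[0,t)}\widetilde\beta\,d\mu_g\Big),\qquad \widetilde\beta=\beta \text{ off } D_g,\quad \widetilde\beta=\frac{\ln(1+\beta\,\Delta^+g)}{\Delta^+g}\text{ on } D_g ,$$ with the principal logarithm. Let $n\ge 0$, $P,Q,x_0,v_0\in\mathbb F$, $f\in\mathcal{BC}_g^n([0,T];\mathbb F)$, and assume $1+\lambda\,\Delta^+g(t)\ne 0$ for all $t\in[0,T)\cap D_g$ and all $\lambda\in\mathbb F$ with $\lambda^2+P\lambda+Q=0$. Then the problem $$v''_g(t)+P\,v'_g(t)+Q\,v(t)=f(t)\quad\text{for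 all } t\in[0,T],\qquad v(0)=x_0,\quad v'_g(0)=v_0,$$ has a solution $v\in\mathcal{BC}_g^{n+2}([0,T];\mathbb F)$, and it is the only solution in $\mathcal{BC}_g^{2}([0,T];\mathbb F)$ (in particular, in $\mathcal{BC}_g^{n+2}([0,T];\mathbb F)$). Moreover, let $\lambda_1,\lambda_2\in\mathbb C$ be the two roots of $\lambda^2+P\lambda+Q$, counted with multiplicity and in either order, and write $E_i(t)=\exp_g(\lambda_i;0,t)$. Then for all $t\in[0,T]$ $$v(t)=x_0E_2(t)+(v_0-\lambda_2x_0)E_2(t)\int_{[0,t)}\frac{E_2(s)^{-1}E_1(s)}{1+\lambda_2\Delta^+g(s)}\,d\mu_g(s)+E_2(t)\int_{[0,t)}\frac{E_2(s)^{-1}E_1(s)}{1+\lambda_2\Delta^+g(s)}\Big(\int_{[0,s)}\frac{E_1(r)^{-1}f(r)}{1+\lambda_1\Delta^+g(r)}\,d\mu_g(r)\Big)d\mu_g(s),$$ where all the integrands are $\mu_g$-integrable. The last summand equals $\int_{\mathbb R} G(t,r)f(r)\,d\mu_g(r)$, with $G(t,\cdot)f$ integrable, for the Green's function $$G(t,r)=\frac{E_2(t)E_1(r)^{-1}}{1+\lambda_1\Delta^+g(r)}\,\chi_{[0,t)}(r)\int_{(r,t)}\frac{1}{1+\lambda_2\Delta^+g(s)}\exp_g\Big(\frac{\lambda_1-\lambda_2}{1+\lambda_2\Delta^+g};0,s\Big)d\mu_g(s).$$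 For all $t,r\in[0,T]$: if $\lambda_1\neq\lambda_2$, then $$G(t,r)=\frac{1}{\lambda_1-\lambda_2}\Big(\frac{E_1(t)E_1(r)^{-1}}{1+\lambda_1\Delta^+g(r)}-\frac{E_2(t)E_2(r)^{-1}}{1+\lambda_2\Delta^+g(r)}\Big)\chi_{[0,t)}(r),$$ and if $\lambda_1=\lambda_2=\lambda$, with $E=E_1=E_2$, then $$G(t,r)=\frac{E(t)E(r)^{-1}}{1+\lambda\Delta^+g(r)}\,\chi_{[0,t)}(r)\Big(\int_{[0,t)}\frac{d\mu_g(s)}{1+\lambda\Delta^+g(s)}-\int_{[0,r)}\frac{d\mu_g(s)}{1+\lambda\Delta^+g(s)}-\frac{\Delta^+g(r)}{1+\lambda\Delta^+g(r)}\Big).$$ -/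

import Mathlib

open Set Filter Topology MeasureTheory

/-- A derivator: a nondecreasing, left-continuous function `g : ℝ → ℝ`. -/
structure Derivator where
  toFun : ℝ → ℝ
  mono : Monotone toFun
  leftCont : ∀ t, ContinuousWithinAt toFun (Iic t) t

instance : CoeFun Derivator (fun _ => ℝ → ℝ) := ⟨Derivator.toFun⟩

namespace Derivator

/-- The jump `Δ⁺g(t) = g(t⁺) - g(t)`. -/
noncomputable def jump (g : Derivator) (t : ℝ) : ℝ := Function.rightLim g t - g t

/-- The set `D_g` of discontinuity points of `g`. -/
def D (g : Derivator) : Set ℝ := {t | 0 < g.jump t}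

/-- The open set `C_g` of points around which `g` is constant. -/
def C (g : Derivator) : Set ℝ := {t | ∃ ε > 0, ∀ s ∈ Ioo (t - ε) (t + ε), g s = g t}

/-- `N_g⁻`: the left endpoints of connected components of `C_g` that are not in `D_g`. -/
def Nminus (g : Derivator) : Set ℝ := {a | a ∉ g.C ∧ ∃ b > a, Ioo a b ⊆ g.C} \ g.D

/-- `N_g⁺`: the right endpoints of connected components of `C_g` that are not in `D_g`. -/
def Nplus (g : Derivator) : Set ℝ := {b | b ∉ g.C ∧ ∃ a < b, Ioo a b ⊆ g.C} \ g.D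

/-- For `t ∈ C_g`, the right endpoint of the connected component of `C_g` containing `t`. -/
noncomputable def rightEnd (g : Derivator) (t : ℝ) : ℝ := sSup {b | Ico t b ⊆ g.C}

/-- The Lebesgue-Stieltjes measure `μ_g`, with `μ_g [c, d) = g d - g c`. -/
noncomputable def measure (g : Derivator) : Measure ℝ := g.mono.stieltjesFunction.measure

theorem measure_Ico (g : Derivator) (c d : ℝ) :
    g.measure (Ico c d) = ENNReal.ofReal (g d - g c) := by
  have key : ∀ x : ℝ, Function.leftLim g.mono.stieltjesFunction x = g x := by
    intro x
    have h1 : Tendsto g (𝓝[<] x) (𝓝 (g x)) :=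
      (g.leftCont x).mono_left (nhdsWithin_mono x Iio_subset_Iic_self)
    have h2 : Tendsto g.mono.stieltjesFunction (𝓝[<] x)
        (𝓝 (Function.leftLim g.mono.stieltjesFunction x)) :=
      g.mono.stieltjesFunction.mono.tendsto_leftLim x
    apply le_antisymm
    · refine le_of_tendsto h2 ?_
      filter_upwards [self_mem_nhdsWithin] with y hy
      rw [Monotone.stieltjesFunction_eq]
      exact g.mono.rightLim_le hy
    · refine le_of_tendsto_of_tendsto h1 h2 ?_
      filter_upwards with y
      rw [Monotone.stieltjesFunction_eq]
      exact g.mono.le_rightLim le_rfl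
  rw [measure, StieltjesFunction.measure_Ico, key, key]

end Derivator

section Spaces

variable {𝕜 : Type*} [RCLike 𝕜]

/-- The point at which the difference quotient for the `g`-derivative at `t` is based:
the right endpoint of the component of `t` if `t ∈ C_g`, and `t` itself otherwise. -/
noncomputable def gBase (g : Derivator) (t : ℝ) : ℝ :=
  open scoped Classical in if t ∈ g.C then g.rightEnd t else t

/-- The filter along which the limit in the `g`-derivative at `t` of a function on `[0, T]` is
taken: `s → t⁺` if `t ∈ D_g`, `s → b⁺` if `t` lies in the component `(a, b)` of `C_g`, and
otherwise `s → t` over the domain `{s ∈ [0, T] | g s ≠ g t}` of the difference quotient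
(hence one-sided limits at the points of `N_g⁺ ∪ N_g⁻`). -/
noncomputable def gFilter (g : Derivator) (T t : ℝ) : Filter ℝ :=
  open scoped Classical in
  if t ∈ g.C ∪ g.D then 𝓝[Ioc (gBase g t) T] (gBase g t)
  else 𝓝[{s | s ∈ Icc 0 T ∧ g s ≠ g t}] t

/-- The difference quotient `(f s - f b) / (g s - g b)`, `b` being the base point of `t`. -/
noncomputable def gQuotient (g : Derivator) (f : ℝ → 𝕜) (t s : ℝ) : 𝕜 :=
  (f s - f (gBase g t)) / ((g s - g (gBase g t) : ℝ) : 𝕜)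

/-- `f : [0, T] → 𝕜` is `g`-differentiable at `t`. -/
def GDifferentiableAt (g : Derivator) (T : ℝ) (f : ℝ → 𝕜) (t : ℝ) : Prop :=
  ∃ L : 𝕜, Tendsto (gQuotient g f t) (gFilter g T t) (𝓝 L)

/-- The `g`-derivative of `f : [0, T] → 𝕜` (meaningful where `f` is `g`-differentiable). -/
noncomputable def gDeriv (g : Derivator) (T : ℝ) (f : ℝ → 𝕜) (t : ℝ) : 𝕜 :=
  limUnder (gFilter g T t) (gQuotient g f t)

/-- The iterated `g`-derivative of order `k`. -/
noncomputable def gIterDeriv (g : Derivator) (T : ℝ) (k : ℕ) (f : ℝ → 𝕜) : ℝ → 𝕜 :=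
  (gDeriv g T)^[k] f

/-- `g`-continuity on `[0, T]`. -/
def GContinuousOn (g : Derivator) (T : ℝ) (f : ℝ → 𝕜) : Prop :=
  ∀ t ∈ Icc 0 T, ∀ ε > 0, ∃ δ > 0, ∀ s ∈ Icc 0 T, |g t - g s| < δ → ‖f t - f s‖ < ε

/-- The space `C_g^k([0, T]; 𝕜)`. -/
def MemC (g : Derivator) (T : ℝ) (k : ℕ) (f : ℝ → 𝕜) : Prop :=
  (∀ j < k, ∀ t ∈ Icc 0 T, GDifferentiableAt g T (gIterDeriv g T j f) t) ∧
  ∀ j ≤ k, GContinuousOn g T (gIterDeriv g T j f)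

/-- The space `BC_g^k([0, T]; 𝕜)`. -/
def MemBC (g : Derivator) (T : ℝ) (k : ℕ) (f : ℝ → 𝕜) : Prop :=
  MemC g T k f ∧ ∀ j ≤ k, ∃ M : ℝ, ∀ t ∈ Icc 0 T, ‖gIterDeriv g T j f t‖ ≤ M

/-- `v ∈ BC_g^2([0, T]; 𝕜)` solves `v'' + P v' + Q v = f` on `[0, T]`, `v(0) = x₀`,
`v'(0) = v₀`, with `g`-derivatives. -/
def IsSolution (g : Derivator) (T : ℝ) (P Q : 𝕜) (f : ℝ → 𝕜) (x₀ v₀ : 𝕜) (v : ℝ → 𝕜) : Prop :=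
  MemBC g T 2 v ∧
  (∀ t ∈ Icc 0 T, gIterDeriv g T 2 v t + P * gIterDeriv g T 1 v t + Q * v t = f t) ∧
  v 0 = x₀ ∧ gIterDeriv g T 1 v 0 = v₀

/-- The inclusion of `𝕜` (that is, of `ℝ` or `ℂ`) in `ℂ`. -/
noncomputable def toC (z : 𝕜) : ℂ := ⟨RCLike.re z, RCLike.im z⟩

end Spaces

section Exponential

/-- The modified coefficient: `β` off `D_g`, and `ln(1 + β Δ⁺g) / Δ⁺g` on `D_g`. -/
noncomputable def gTilde (g : Derivator) (β : ℝ → ℂ) (s : ℝ) : ℂ :=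
  open scoped Classical in
  if s ∈ g.D then Complex.log (1 + β s * g.jump s) / g.jump s else β s

/-- The complex `g`-exponential `exp_g(β; 0, t)`, for `g`-integrable `β` with
`1 + β Δ⁺g ≠ 0` on `D_g`. -/
noncomputable def gExp (g : Derivator) (β : ℝ → ℂ) (t : ℝ) : ℂ :=
  Complex.exp (∫ s in Ico 0 t, gTilde g β s ∂g.measure)

/-- The `g`-exponential of a constant. -/
noncomputable def gExpConst (g : Derivator) (l : ℂ) (t : ℝ) : ℂ := gExp g (fun _ => l) t

/-- The function `exp_g(l; 0, s)⁻¹ / (1 + l Δ⁺g(s))`. -/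
noncomputable def gWeight (g : Derivator) (l : ℂ) (s : ℝ) : ℂ :=
  (gExpConst g l s)⁻¹ / (1 + l * g.jump s)

/-- The part of the explicit solution that carries the initial data. -/
noncomputable def homPart (g : Derivator) (l₁ l₂ x₀ v₀ : ℂ) (t : ℝ) : ℂ :=
  x₀ * gExpConst g l₂ t + (v₀ - l₂ * x₀) * gExpConst g l₂ t *
    ∫ s in Ico 0 t, gWeight g l₂ s * gExpConst g l₁ s ∂g.measure

/-- The part of the explicit solution that carries the right-hand side `f`. -/
noncomputable def forcedPart (g : Derivator) (l₁ l₂ : ℂ) (f : ℝ → ℂ) (t : ℝ) : ℂ :=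
  gExpConst g l₂ t * ∫ s in Ico 0 t, gWeight g l₂ s * gExpConst g l₁ s *
    (∫ r in Ico 0 s, gWeight g l₁ r * f r ∂g.measure) ∂g.measure

/-- The Green's function of the second order problem with characteristic roots `l₁, l₂`. -/
noncomputable def gGreen (g : Derivator) (l₁ l₂ : ℂ) (t r : ℝ) : ℂ :=
  gExpConst g l₂ t * (gExpConst g l₁ r)⁻¹ * (1 + l₁ * g.jump r)⁻¹ *
    (Ico 0 t).indicator (fun _ => (1 : ℂ)) r *
    ∫ s in Ioo r t, (1 + l₂ * g.jump s)⁻¹ *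
      gExp g (fun u => (l₁ - l₂) / (1 + l₂ * g.jump u)) s ∂g.measure

end Exponential

/-! The problem is moved from `g`-derivatives to integrals. Call `F` a primitive of `φ` when `F(t) =
c + ∫_{[0,t)} φ dμ_g`. The fundamental theorem of calculus holds in both directions: a primitive of
a bounded `g`-continuous `φ` has `g`-derivative `φ` (`IsPrimitive.tendsto_gQuotient`), and a
`BC_g^1` function is a primitive of its `g`-derivative (`MemBC.isPrimitive`), because a
`g`-continuous function with zero `g`-derivative is constant.

Primitives obey a product rule with an extra term `φψΔ⁺g` from the atoms. Iterating it for powers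
and summing the exponential series gives the chain rule `IsPrimitive.cexp`: `exp H` is a primitive
of `β exp H` when `βΔ⁺g = exp(hΔ⁺g) - 1`. The modified coefficient `gTilde` is made for this
relation, so `E_l' = l E_l`.

The operator factors as `(D - l₁)(D - l₂)`. For a solution `v`, `y = v' - l₂ v` satisfies `y' = l₁ y
+ f` and `v' = l₂ v + y`; variation of constants, with the weight `E⁻¹ / (1 + lΔ⁺g)`, solves both.
Since every solution is given by the resulting formula, uniqueness follows (`IsSolution.toC_eq`).
For existence the two equations are solved over `ℂ` and the result is projected to `𝕜` by a
real-linear retraction that commutes with multiplication by `P` and `Q` (`exists_solution`);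
regularity is then bootstrapped from the integral equations. The Green's function comes from Fubini
on `r < s < t`, and its closed forms from the primitive formula for `E₁ / E₂`. -/

/-! ### Calculus of primitives with respect to a finite measure with atoms. -/

section Primitive

/-- On `A`, the function `F` is the primitive of the `ν`-integrable function `φ` that starts
from `c`. -/
structure IsPrimitive {E : Type*} [NormedAddCommGroup E] [NormedSpace ℝ E] (ν : Measure ℝ)
    (A : Set ℝ) (c : E) (F φ : ℝ → E) : Prop where
  integrable : Integrable φ ν
  eq : ∀ t ∈ A, F t = c + ∫ s in Iio t, φ s ∂ν

variable {ν : Measure ℝ}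

/-- The mass of an atom is the difference of two monotone distribution functions. -/
theorem measurable_measureReal_singleton [IsFiniteMeasure ν] : Measurable fun s : ℝ => ν.real {s} := by
  have h1 : Monotone fun s : ℝ => ν.real (Iic s) := fun a b h =>
    measureReal_mono (Iic_subset_Iic.2 h)
  have h2 : Monotone fun s : ℝ => ν.real (Iio s) := fun a b h =>
    measureReal_mono (Iio_subset_Iio h)
  have h3 : (fun s : ℝ => ν.real {s}) = fun s => ν.real (Iic s) - ν.real (Iio s) := by
    funext s
    rw [← Iio_union_right, measureReal_union (by simp) (measurableSet_singleton s)]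
    ring
  rw [h3]
  exact h1.measurable.sub h2.measurable

theorem aestronglyMeasurable_setIntegral_Iio [IsFiniteMeasure ν] {φ : ℝ → ℂ} (hφ : Integrable φ ν) :
    AEStronglyMeasurable (fun t => ∫ s in Iio t, φ s ∂ν) ν := by
  have h : AEStronglyMeasurable
      ({p : ℝ × ℝ | p.2 < p.1}.indicator fun p => φ p.2) (ν.prod ν) :=
    hφ.aestronglyMeasurable.comp_snd.indicator (measurableSet_lt measurable_snd measurable_fst)
  refine h.integral_prod_right'.congr (ae_of_all _ fun t => ?_)
  change ∫ y, ({p : ℝ × ℝ | p.2 < p.1}.indicator fun p => φ p.2) (t, y) ∂ν = _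
  beta_reduce
  rw [← integral_indicator measurableSet_Iio]
  rfl

theorem norm_setIntegral_le_integral_norm {E : Type*} [NormedAddCommGroup E] [NormedSpace ℝ E]
    {φ : ℝ → E} (hφ : Integrable φ ν) (s : Set ℝ) :
    ‖∫ x in s, φ x ∂ν‖ ≤ ∫ x, ‖φ x‖ ∂ν :=
  (norm_integral_le_integral_norm _).trans
    (setIntegral_le_integral hφ.norm (ae_of_all _ fun _ => norm_nonneg _))

theorem mul_measureReal_singleton_eq (φ : ℝ → ℂ) (s : ℝ) :
    φ s * ν.real {s} = ∫ x in {s}, φ x ∂ν := by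
  rw [integral_singleton, Complex.real_smul, mul_comm]

theorem integrable_mul_setIntegral_Iio [IsFiniteMeasure ν] {φ ψ : ℝ → ℂ} (hφ : Integrable φ ν)
    (hψ : Integrable ψ ν) : Integrable (fun t => (∫ s in Iio t, φ s ∂ν) * ψ t) ν :=
  hψ.bdd_mul (aestronglyMeasurable_setIntegral_Iio hφ)
    (ae_of_all _ fun _ => norm_setIntegral_le_integral_norm hφ _)

theorem integrable_mul_mul_singleton [IsFiniteMeasure ν] {φ ψ : ℝ → ℂ} (hφ : Integrable φ ν)
    (hψ : Integrable ψ ν) : Integrable (fun t => φ t * ψ t * ν.real {t}) ν := by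
  have h : Integrable (fun t => (φ t * ν.real {t}) * ψ t) ν := by
    refine hψ.bdd_mul (c := ∫ x, ‖φ x‖ ∂ν) ?_ (ae_of_all _ fun s => ?_)
    · exact hφ.aestronglyMeasurable.mul
        (Complex.measurable_ofReal.comp measurable_measureReal_singleton).aestronglyMeasurable
    · rw [mul_measureReal_singleton_eq]
      exact norm_setIntegral_le_integral_norm hφ _
  exact h.congr (ae_of_all _ fun s => by ring)

section Swap

variable {φ ψ : ℝ → ℂ} (t : ℝ)

theorem integrable_triangle (hφ : Integrable φ ν) (hψ : Integrable ψ ν) :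
    Integrable ({p : ℝ × ℝ | p.1 < p.2 ∧ p.2 < t}.indicator fun p => φ p.1 * ψ p.2)
      (ν.prod ν) :=
  (hφ.mul_prod hψ).indicator
    ((measurableSet_lt measurable_fst measurable_snd).inter
      (measurableSet_lt measurable_snd measurable_const))

theorem integral_triangle_right (x : ℝ) :
    ∫ y, ({p : ℝ × ℝ | p.1 < p.2 ∧ p.2 < t}.indicator fun p => φ p.1 * ψ p.2) (x, y) ∂ν =
      φ x * ∫ y in Ioo x t, ψ y ∂ν := by
  rw [← integral_const_mul, ← integral_indicator measurableSet_Ioo]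
  rfl

theorem integral_triangle_left (y : ℝ) :
    ∫ x, ({p : ℝ × ℝ | p.1 < p.2 ∧ p.2 < t}.indicator fun p => φ p.1 * ψ p.2) (x, y) ∂ν =
      (Iio t).indicator (fun y => ψ y * ∫ x in Iio y, φ x ∂ν) y := by
  by_cases hy : y < t
  · rw [indicator_of_mem (mem_Iio.2 hy), ← integral_const_mul,
      ← integral_indicator measurableSet_Iio]
    refine integral_congr_ae (ae_of_all _ fun x => ?_)
    simp only [indicator, mem_ofPred_eq, hy, and_true, mem_Iio]
    split_ifs
    · ring
    · rfl
  · rw [indicator_of_notMem (by simpa using hy)]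
    simp [indicator, hy]

theorem integrable_mul_setIntegral_Ioo [IsFiniteMeasure ν] (hφ : Integrable φ ν) (hψ : Integrable ψ ν) :
    Integrable (fun x => φ x * ∫ y in Ioo x t, ψ y ∂ν) ν := by
  have h := (integrable_triangle t hφ hψ).integral_prod_left
  simpa only [integral_triangle_right] using h

/-- Fubini on the open triangle `x < y < t`. It serves both integration by parts and the passage
from the nested integral to the Green's kernel. -/
theorem integral_mul_setIntegral_Ioo [IsFiniteMeasure ν] (hφ : Integrable φ ν) (hψ : Integrable ψ ν) :
    ∫ x, φ x * ∫ y in Ioo x t, ψ y ∂ν ∂ν = ∫ y in Iio t, ψ y * ∫ x in Iio y, φ x ∂ν ∂ν := by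
  rw [← integral_indicator measurableSet_Iio]
  simp only [← integral_triangle_right, ← integral_triangle_left]
  exact integral_integral_swap (f := fun x y =>
    ({p : ℝ × ℝ | p.1 < p.2 ∧ p.2 < t}.indicator fun p => φ p.1 * ψ p.2) (x, y))
    (integrable_triangle t hφ hψ)

theorem setIntegral_Iio_split (hψ : Integrable ψ ν) {x t : ℝ} (hx : x < t) :
    ∫ y in Iio t, ψ y ∂ν = (∫ y in Iio x, ψ y ∂ν) + ψ x * ν.real {x} + ∫ y in Ioo x t, ψ y ∂ν := by
  have h1 : Iio t = (Iio x ∪ {x}) ∪ Ioo x t := by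
    rw [Iio_union_right, Iic_union_Ioo_eq_Iio hx]
  rw [h1, setIntegral_union, setIntegral_union, mul_measureReal_singleton_eq]
  · simp
  · exact measurableSet_singleton x
  · exact hψ.integrableOn
  · exact hψ.integrableOn
  · rw [Iio_union_right]
    exact Set.disjoint_left.2 fun a ha hb => absurd hb.1 (not_lt.2 ha)
  · exact measurableSet_Ioo
  · exact hψ.integrableOn
  · exact hψ.integrableOn

/-- Integration by parts: the square is cut into two open triangles and the diagonal, and the
diagonal is charged only by atoms, whence the term with `ν.real {s}`. -/
theorem setIntegral_Iio_mul [IsFiniteMeasure ν] (hφ : Integrable φ ν) (hψ : Integrable ψ ν) :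
    (∫ s in Iio t, φ s ∂ν) * ∫ s in Iio t, ψ s ∂ν =
      ∫ s in Iio t, ((∫ r in Iio s, φ r ∂ν) * ψ s + φ s * (∫ r in Iio s, ψ r ∂ν) +
        φ s * ψ s * ν.real {s}) ∂ν := by
  have i1 := integrable_mul_setIntegral_Iio hφ hψ
  have i2 : Integrable (fun s => φ s * (∫ r in Iio s, ψ r ∂ν)) ν :=
    (integrable_mul_setIntegral_Iio hψ hφ).congr (ae_of_all _ fun s => mul_comm _ _)
  have i3 := integrable_mul_mul_singleton hφ hψ
  have i4 := integrable_mul_setIntegral_Ioo t hφ hψ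
  have h4 : ∫ x in Iio t, φ x * ∫ y in Ioo x t, ψ y ∂ν ∂ν =
      ∫ s in Iio t, (∫ r in Iio s, φ r ∂ν) * ψ s ∂ν := by
    -- For `x ≥ t` the interval `Ioo x t` is empty, so the outer integral may run over the whole
    -- line.
    rw [setIntegral_eq_integral_of_forall_compl_eq_zero, integral_mul_setIntegral_Ioo t hφ hψ]
    · simp only [mul_comm]
    · intro x hx
      rw [Ioo_eq_empty (by simpa using hx)]
      simp
  have i12 : Integrable (fun s => (∫ r in Iio s, φ r ∂ν) * ψ s +
    φ s * (∫ r in Iio s, ψ r ∂ν)) ν := i1.add i2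
  have i23 : Integrable (fun s => φ s * (∫ r in Iio s, ψ r ∂ν) +
    φ s * ψ s * ν.real {s}) ν := i2.add i3
  rw [← integral_mul_const, integral_add i12.integrableOn i3.integrableOn,
    integral_add i1.integrableOn i2.integrableOn, ← h4,
    add_assoc, add_comm, ← integral_add i2.integrableOn i3.integrableOn,
    ← integral_add i23.integrableOn i4.integrableOn]
  refine setIntegral_congr_fun measurableSet_Iio fun x hx => ?_
  rw [setIntegral_Iio_split hψ hx]
  ring

end Swap

namespace IsPrimitive

variable {A : Set ℝ} {c d : ℂ} {F G φ ψ : ℝ → ℂ}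

theorem congr_deriv {E : Type*} [NormedAddCommGroup E] [NormedSpace ℝ E] {ν : Measure ℝ} {c : E}
    {F φ ψ : ℝ → E} (h : IsPrimitive ν A c F φ) (hψ : φ =ᵐ[ν] ψ) : IsPrimitive ν A c F ψ where
  integrable := h.integrable.congr hψ
  eq t ht := by rw [h.eq t ht, integral_congr_ae (ae_restrict_of_ae hψ)]

theorem congr_fun {E : Type*} [NormedAddCommGroup E] [NormedSpace ℝ E] {ν : Measure ℝ} {c : E}
    {F G φ : ℝ → E} (h : IsPrimitive ν A c F φ) (hG : ∀ t ∈ A, G t = F t) :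
    IsPrimitive ν A c G φ where
  integrable := h.integrable
  eq t ht := by rw [hG t ht, h.eq t ht]

theorem add {E : Type*} [NormedAddCommGroup E] [NormedSpace ℝ E] {ν : Measure ℝ} {c d : E}
    {F G φ ψ : ℝ → E} (h : IsPrimitive ν A c F φ) (h' : IsPrimitive ν A d G ψ) :
    IsPrimitive ν A (c + d) (fun t => F t + G t) (fun t => φ t + ψ t) where
  integrable := h.integrable.add h'.integrable
  eq t ht := by
    rw [integral_add h.integrable.integrableOn h'.integrable.integrableOn, h.eq t ht, h'.eq t ht]
    abel

theorem clm_comp {E E' : Type*} [NormedAddCommGroup E] [NormedSpace ℝ E] [CompleteSpace E]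
    [NormedAddCommGroup E'] [NormedSpace ℝ E'] [CompleteSpace E'] {ν : Measure ℝ} {c : E}
    {F φ : ℝ → E} (h : IsPrimitive ν A c F φ) (L : E →L[ℝ] E') :
    IsPrimitive ν A (L c) (fun t => L (F t)) (fun t => L (φ t)) where
  integrable := L.integrable_comp h.integrable
  eq t ht := by
    rw [L.integral_comp_comm h.integrable.integrableOn, h.eq t ht, map_add]

theorem const_mul (h : IsPrimitive ν A c F φ) (a : ℂ) :
    IsPrimitive ν A (a * c) (fun t => a * F t) (fun t => a * φ t) where
  integrable := h.integrable.const_mul a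
  eq t ht := by rw [integral_const_mul, h.eq t ht]; ring

theorem of_integrable {E : Type*} [NormedAddCommGroup E] [NormedSpace ℝ E] {ν : Measure ℝ}
    {φ : ℝ → E} (hφ : Integrable φ ν) (A : Set ℝ) (c : E) :
    IsPrimitive ν A c (fun t => c + ∫ s in Iio t, φ s ∂ν) φ :=
  ⟨hφ, fun _ _ => rfl⟩

theorem const (A : Set ℝ) (c : ℂ) : IsPrimitive ν A c (fun _ => c) (fun _ => 0) :=
  ⟨integrable_zero _ _ _, fun _ _ => by simp⟩

theorem ae_eq (h : IsPrimitive ν A c F φ) (hA : ∀ᵐ t ∂ν, t ∈ A) :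
    F =ᵐ[ν] fun t => c + ∫ s in Iio t, φ s ∂ν := by
  filter_upwards [hA] with t ht using h.eq t ht

theorem aestronglyMeasurable [IsFiniteMeasure ν] (h : IsPrimitive ν A c F φ) (hA : ∀ᵐ t ∂ν, t ∈ A) :
    AEStronglyMeasurable F ν :=
  (aestronglyMeasurable_const.add (aestronglyMeasurable_setIntegral_Iio h.integrable)).congr
    (h.ae_eq hA).symm

theorem exists_bound {E : Type*} [NormedAddCommGroup E] [NormedSpace ℝ E] {ν : Measure ℝ} {c : E}
    {F φ : ℝ → E} (h : IsPrimitive ν A c F φ) : ∃ M : ℝ, ∀ t ∈ A, ‖F t‖ ≤ M := by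
  refine ⟨‖c‖ + ∫ x, ‖φ x‖ ∂ν, fun t ht => ?_⟩
  rw [h.eq t ht]
  exact (norm_add_le _ _).trans
    (add_le_add le_rfl (norm_setIntegral_le_integral_norm h.integrable _))

theorem integrable_mul [IsFiniteMeasure ν] (h : IsPrimitive ν A c F φ) (hA : ∀ᵐ t ∂ν, t ∈ A)
    (hψ : Integrable ψ ν) : Integrable (fun t => F t * ψ t) ν := by
  obtain ⟨M, hM⟩ := h.exists_bound
  refine hψ.bdd_mul (c := M) (h.aestronglyMeasurable hA) ?_
  filter_upwards [hA] with t ht using hM t ht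

theorem integrable_self [IsFiniteMeasure ν] (h : IsPrimitive ν A c F φ) (hA : ∀ᵐ t ∂ν, t ∈ A) : Integrable F ν := by
  simpa using h.integrable_mul hA (integrable_const (1 : ℂ))

/-- The product rule. -/
theorem mul [IsFiniteMeasure ν] (h : IsPrimitive ν A c F φ) (h' : IsPrimitive ν A d G ψ) (hA : ∀ᵐ t ∂ν, t ∈ A) :
    IsPrimitive ν A (c * d) (fun t => F t * G t)
      (fun t => F t * ψ t + φ t * G t + φ t * ψ t * ν.real {t}) := by
  have hφ := h.integrable
  have hψ := h'.integrable
  have i1 := integrable_mul_setIntegral_Iio hφ hψ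
  have i2 : Integrable (fun s => φ s * (∫ r in Iio s, ψ r ∂ν)) ν :=
    (integrable_mul_setIntegral_Iio hψ hφ).congr (ae_of_all _ fun s => mul_comm _ _)
  have i3 := integrable_mul_mul_singleton hφ hψ
  have key : (fun t => (c * ψ t + d * φ t) + ((∫ r in Iio t, φ r ∂ν) * ψ t +
      φ t * (∫ r in Iio t, ψ r ∂ν) + φ t * ψ t * ν.real {t})) =ᵐ[ν]
      fun t => F t * ψ t + φ t * G t + φ t * ψ t * ν.real {t} := by
    filter_upwards [h.ae_eq hA, h'.ae_eq hA] with t h1 h2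
    rw [h1, h2]
    ring
  have j1 : Integrable (fun t => c * ψ t + d * φ t) ν := (hψ.const_mul c).add (hφ.const_mul d)
  have j2 : Integrable (fun t => (∫ r in Iio t, φ r ∂ν) * ψ t +
      φ t * (∫ r in Iio t, ψ r ∂ν) + φ t * ψ t * ν.real {t}) ν := (i1.add i2).add i3
  refine IsPrimitive.congr_deriv ⟨j1.add j2, fun t ht => ?_⟩ key
  rw [integral_add' j1.integrableOn j2.integrableOn,
    integral_add (hψ.const_mul c).integrableOn (hφ.const_mul d).integrableOn,
    integral_const_mul, integral_const_mul, ← setIntegral_Iio_mul t hφ hψ, h.eq t ht, h'.eq t ht]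
  ring

/-- With `b = F t` and `a = F t + φ t * ν.real {t}` the value just after the atom, the sum is `(aⁿ -
bⁿ)/(a - b)`, and it becomes `n bⁿ⁻¹` where there is no atom. -/
theorem pow [IsFiniteMeasure ν] (h : IsPrimitive ν A 0 F φ) (hA : ∀ᵐ t ∂ν, t ∈ A) (n : ℕ) :
    IsPrimitive ν A (0 ^ n) (fun t => F t ^ n) (fun t => φ t *
      ∑ i ∈ Finset.range n, (F t + φ t * ν.real {t}) ^ i * F t ^ (n - 1 - i)) := by
  induction n with
  | zero => simpa using IsPrimitive.const (ν := ν) A 1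
  | succ n ih =>
    have h1 := h.mul ih hA
    rw [← pow_succ'] at h1
    refine (h1.congr_fun fun t _ => pow_succ' _ _).congr_deriv (ae_of_all _ fun t => ?_)
    simp only
    rw [Finset.sum_range_succ']
    have h2 : ∀ i ∈ Finset.range n, (F t + φ t * ν.real {t}) ^ (i + 1) * F t ^ (n + 1 - 1 - (i + 1))
        = (F t + φ t * ν.real {t}) * ((F t + φ t * ν.real {t}) ^ i * F t ^ (n - 1 - i)) := by
      intro i hi
      rw [pow_succ', show n + 1 - 1 - (i + 1) = n - 1 - i by omega, mul_assoc]
    rw [Finset.sum_congr rfl h2, ← Finset.mul_sum]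
    simp
    ring

end IsPrimitive

theorem norm_geom_sum₂_le {a b : ℂ} {B : ℝ} (ha : ‖a‖ ≤ B) (hb : ‖b‖ ≤ B) (n : ℕ) :
    ‖∑ i ∈ Finset.range (n + 1), a ^ i * b ^ (n + 1 - 1 - i)‖ ≤ (n + 1) * B ^ n := by
  have hB : 0 ≤ B := (norm_nonneg _).trans ha
  have h : ∀ i ∈ Finset.range (n + 1), ‖a ^ i * b ^ (n + 1 - 1 - i)‖ ≤ B ^ n := by
    intro i hi
    rw [norm_mul, norm_pow, norm_pow]
    calc ‖a‖ ^ i * ‖b‖ ^ (n + 1 - 1 - i) ≤ B ^ i * B ^ (n + 1 - 1 - i) := by gcongr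
      _ = B ^ n := by
        rw [← pow_add]
        congr 1
        have := Finset.mem_range.1 hi
        omega
  refine (norm_sum_le_of_le _ h).trans ?_
  simp

theorem hasSum_pow_succ_div_factorial (z : ℂ) :
    HasSum (fun n : ℕ => z ^ (n + 1) / ((n + 1).factorial : ℂ)) (Complex.exp z - 1) := by
  have h := NormedSpace.expSeries_div_hasSum_exp (𝔸 := ℂ) z
  rw [← Complex.exp_eq_exp_ℂ] at h
  rw [hasSum_nat_add_iff' 1 (f := fun n : ℕ => z ^ n / (n.factorial : ℂ)) |>.symm] at h
  simpa using h

/-- For `m ≠ 0` the geometric sums collapse to `((H + hm)ⁿ⁺¹ - Hⁿ⁺¹)/m`, and the exponential series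
gives `(exp(H + hm) - exp H)/m`. For `m = 0` each is `(n + 1)Hⁿ`. -/
theorem hasSum_mul_geom_sum₂_div_factorial {H h β : ℂ} {m : ℝ}
    (hβ : β * m = Complex.exp (h * m) - 1) (hβ0 : m = 0 → β = h) :
    HasSum (fun n : ℕ => (h * ∑ i ∈ Finset.range (n + 1),
      (H + h * m) ^ i * H ^ (n + 1 - 1 - i)) / ((n + 1).factorial : ℂ)) (Complex.exp H * β) := by
  by_cases hm : m = 0
  · rw [hβ0 hm, mul_comm (Complex.exp H)]
    have h1 := (NormedSpace.expSeries_div_hasSum_exp (𝔸 := ℂ) H).mul_left h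
    rw [← Complex.exp_eq_exp_ℂ] at h1
    refine h1.congr_fun fun n => ?_
    have h2 : ∀ i ∈ Finset.range (n + 1), (H + h * m) ^ i * H ^ (n + 1 - 1 - i) = H ^ n := by
      intro i hi
      rw [hm, Complex.ofReal_zero, mul_zero, add_zero, ← pow_add]
      congr 1
      have := Finset.mem_range.1 hi
      omega
    rw [Finset.sum_congr rfl h2, Finset.sum_const, Finset.card_range, nsmul_eq_mul,
      Nat.factorial_succ, Nat.cast_mul]
    have := Nat.cast_ne_zero (R := ℂ).2 n.factorial_ne_zero
    have := Nat.cast_ne_zero (R := ℂ).2 n.succ_ne_zero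
    field_simp
  · have hm' : (m : ℂ) ≠ 0 := Complex.ofReal_ne_zero.2 hm
    have h1 := ((hasSum_pow_succ_div_factorial (H + h * m)).sub
      (hasSum_pow_succ_div_factorial H)).mul_right ((m : ℂ)⁻¹)
    have h2 : (Complex.exp (H + h * m) - 1 - (Complex.exp H - 1)) * (m : ℂ)⁻¹ =
        Complex.exp H * β := by
      rw [Complex.exp_add]
      field_simp
      linear_combination -Complex.exp H * hβ
    rw [h2] at h1
    refine h1.congr_fun fun n => ?_
    have h3 := (Commute.all (H + h * m) H).geom_sum₂_mul (n + 1)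
    rw [← sub_div, ← h3, add_sub_cancel_left]
    field_simp

/-- The chain rule for the exponential of a primitive. -/
theorem IsPrimitive.cexp [IsFiniteMeasure ν] {A : Set ℝ} {H h β : ℝ → ℂ} (hH : IsPrimitive ν A 0 H h)
    (hA : ∀ᵐ t ∂ν, t ∈ A) (hβ : ∀ᵐ s ∂ν, β s * ν.real {s} = Complex.exp (h s * ν.real {s}) - 1)
    (hβ0 : ∀ᵐ s ∂ν, ν.real {s} = 0 → β s = h s) :
    IsPrimitive ν A 1 (fun t => Complex.exp (H t)) (fun t => Complex.exp (H t) * β t) := by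
  -- `B` bounds `H` both before and after each atom, as both values are integrals of `h` over
  -- half-lines.
  set B : ℝ := ∫ x, ‖h x‖ ∂ν with hB
  have hh := hH.integrable
  have hp : ∀ n, IsPrimitive ν A 0 (fun t => H t ^ (n + 1)) (fun t => h t *
      ∑ i ∈ Finset.range (n + 1), (H t + h t * ν.real {t}) ^ i * H t ^ (n + 1 - 1 - i)) := by
    intro n
    simpa using hH.pow hA (n + 1)
  set p : ℕ → ℝ → ℂ := fun n t => (h t * ∑ i ∈ Finset.range (n + 1),
    (H t + h t * ν.real {t}) ^ i * H t ^ (n + 1 - 1 - i)) / ((n + 1).factorial : ℂ) with hpdef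
  have hsum : ∀ᵐ s ∂ν, HasSum (fun n => p n s) (Complex.exp (H s) * β s) := by
    filter_upwards [hβ, hβ0] with s h1 h2 using hasSum_mul_geom_sum₂_div_factorial h1 h2
  have hbd : ∀ n, ∀ᵐ s ∂ν, ‖p n s‖ ≤ ‖h s‖ * (B ^ n / n.factorial) := by
    intro n
    filter_upwards [hH.ae_eq hA] with s hs
    have hH1 : ‖H s‖ ≤ B := by
      rw [hs, zero_add]
      exact norm_setIntegral_le_integral_norm hh _
    have hH2 : ‖H s + h s * ν.real {s}‖ ≤ B := by
      have : H s + h s * ν.real {s} = ∫ x in Iic s, h x ∂ν := by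
        rw [hs, zero_add, mul_measureReal_singleton_eq, ← setIntegral_union (by simp)
          (measurableSet_singleton s) hh.integrableOn hh.integrableOn, Iio_union_right]
      rw [this]
      exact norm_setIntegral_le_integral_norm hh _
    have := norm_geom_sum₂_le hH2 hH1 n
    rw [hpdef]
    simp only
    rw [norm_div, norm_mul, Complex.norm_natCast, mul_div_assoc]
    refine mul_le_mul_of_nonneg_left ?_ (norm_nonneg _)
    rw [Nat.factorial_succ, Nat.cast_mul, div_le_div_iff₀ (by positivity) (by positivity)]
    calc _ ≤ ((n : ℝ) + 1) * B ^ n * n.factorial := by gcongr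
      _ = _ := by push_cast; ring
  have hexp : HasSum (fun n : ℕ => B ^ n / (n.factorial : ℝ)) (Real.exp B) := by
    have h := NormedSpace.expSeries_div_hasSum_exp (𝔸 := ℝ) B
    rwa [← Real.exp_eq_exp_ℝ] at h
  have hmeas : ∀ n, AEStronglyMeasurable (p n) ν := fun n =>
    ((hp n).integrable.div_const _).aestronglyMeasurable
  have hbsum : ∀ s, HasSum (fun n => ‖h s‖ * (B ^ n / (n.factorial : ℝ))) (‖h s‖ * Real.exp B) :=
    fun s => hexp.mul_left _
  -- `β` is not assumed measurable: the product is measurable as a limit of the partial sums and is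
  -- dominated by `‖h‖ exp B`.
  have hint : Integrable (fun t => Complex.exp (H t) * β t) ν := by
    refine (hh.norm.mul_const (Real.exp B)).mono' ?_ ?_
    · have h1 : AEMeasurable (fun s => Complex.exp (H s) * β s) ν := by
        refine aemeasurable_of_tendsto_metrizable_ae atTop
          (f := fun n s => ∑ i ∈ Finset.range n, p i s) (fun n => ?_) ?_
        · exact Finset.aemeasurable_fun_sum _ fun i _ => (hmeas i).aemeasurable
        · filter_upwards [hsum] with s hs using hs.tendsto_sum_nat
      exact h1.aestronglyMeasurable
    · filter_upwards [hsum, ae_all_iff.2 hbd] with s hs hb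
      rw [← hs.tsum_eq]
      exact tsum_of_norm_bounded (hbsum s) hb
  refine ⟨hint, fun t ht => ?_⟩
  have hI := hasSum_integral_of_dominated_convergence (μ := ν.restrict (Iio t)) (F := p)
    (f := fun s => Complex.exp (H s) * β s)
    (fun n s => ‖h s‖ * (B ^ n / (n.factorial : ℝ)))
    (fun n => (hmeas n).restrict) (fun n => ae_restrict_of_ae (hbd n))
    (ae_of_all _ fun s => (hbsum s).summable) ?_ (ae_restrict_of_ae hsum)
  · have hI' : HasSum (fun n => ∫ s in Iio t, p n s ∂ν) (Complex.exp (H t) - 1) := by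
      refine (hasSum_pow_succ_div_factorial (H t)).congr_fun fun n => ?_
      rw [(hp n).eq t ht, zero_add, hpdef]
      simp only
      rw [integral_div]
    rw [← hI'.unique hI]
    ring
  · simp only [fun s => (hbsum s).tsum_eq]
    exact (hh.norm.mul_const _).integrableOn

end Primitive

/-! ### The derivator: its measure, its intervals of constancy and the filters of the
`g`-derivative. -/

namespace Derivator

variable (g : Derivator)

theorem leftLim_stieltjesFunction (x : ℝ) :
    Function.leftLim g.mono.stieltjesFunction x = g x := by
  have h1 : Tendsto g (𝓝[<] x) (𝓝 (g x)) :=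
    (g.leftCont x).mono_left (nhdsWithin_mono x Iio_subset_Iic_self)
  have h2 : Tendsto g.mono.stieltjesFunction (𝓝[<] x)
      (𝓝 (Function.leftLim g.mono.stieltjesFunction x)) :=
    g.mono.stieltjesFunction.mono.tendsto_leftLim x
  apply le_antisymm
  · refine le_of_tendsto h2 ?_
    filter_upwards [self_mem_nhdsWithin] with y hy
    rw [Monotone.stieltjesFunction_eq]
    exact g.mono.rightLim_le hy
  · refine le_of_tendsto_of_tendsto h1 h2 ?_
    filter_upwards with y
    rw [Monotone.stieltjesFunction_eq]
    exact g.mono.le_rightLim le_rfl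

theorem measure_singleton (t : ℝ) : g.measure {t} = ENNReal.ofReal (g.jump t) := by
  rw [measure, StieltjesFunction.measure_singleton, leftLim_stieltjesFunction,
    Monotone.stieltjesFunction_eq, jump]

theorem jump_nonneg (t : ℝ) : 0 ≤ g.jump t := sub_nonneg.2 (g.mono.le_rightLim le_rfl)

theorem jump_eq_zero {t : ℝ} (ht : t ∉ g.D) : g.jump t = 0 :=
  le_antisymm (not_lt.1 ht) (g.jump_nonneg t)

theorem add_jump_le {s t : ℝ} (h : s < t) : g s + g.jump s ≤ g t := by
  rw [jump, add_sub_cancel]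
  exact g.mono.rightLim_le h

theorem tendsto_right (t : ℝ) : Tendsto g (𝓝[>] t) (𝓝 (g t + g.jump t)) := by
  rw [jump, add_sub_cancel]
  exact g.mono.tendsto_rightLim t

theorem tendsto_left (t : ℝ) : Tendsto g (𝓝[<] t) (𝓝 (g t)) :=
  (g.leftCont t).mono_left (nhdsWithin_mono t Iio_subset_Iic_self)

theorem tendsto_right_of_notMem {t : ℝ} (ht : t ∉ g.D) : Tendsto g (𝓝[>] t) (𝓝 (g t)) := by
  simpa [g.jump_eq_zero ht] using g.tendsto_right t

/-- The restriction of `μ_g` to `[0, T)`. -/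
noncomputable def measureOn (T : ℝ) : Measure ℝ := g.measure.restrict (Ico 0 T)

instance (T : ℝ) : IsFiniteMeasure (g.measureOn T) :=
  ⟨by rw [measureOn, Measure.restrict_apply_univ, measure_Ico]; exact ENNReal.ofReal_lt_top⟩

variable {g} {T : ℝ}

theorem ae_mem_Ico : ∀ᵐ t ∂g.measureOn T, t ∈ Ico 0 T := ae_restrict_mem measurableSet_Ico

theorem ae_mem_Icc : ∀ᵐ t ∂g.measureOn T, t ∈ Icc 0 T :=
  ae_mem_Ico.mono fun _ h => Ico_subset_Icc_self h

theorem measureOn_real_singleton {s : ℝ} (hs : s ∈ Ico 0 T) :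
    (g.measureOn T).real {s} = g.jump s := by
  rw [measureReal_def, measureOn, Measure.restrict_apply (measurableSet_singleton s),
    inter_eq_left.2 (singleton_subset_iff.2 hs), measure_singleton,
    ENNReal.toReal_ofReal (g.jump_nonneg s)]

theorem measureOn_restrict_Iio {t : ℝ} (ht : t ∈ Icc 0 T) :
    (g.measureOn T).restrict (Iio t) = g.measure.restrict (Ico 0 t) := by
  rw [measureOn, Measure.restrict_restrict measurableSet_Iio]
  congr 1
  ext x
  simp only [mem_inter_iff, mem_Iio, mem_Ico]
  exact ⟨fun h => ⟨h.2.1, h.1⟩, fun h => ⟨h.2, h.1, h.2.trans_le ht.2⟩⟩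

theorem measureOn_restrict_Ioo {r t : ℝ} (hr : 0 ≤ r) (ht : t ≤ T) :
    (g.measureOn T).restrict (Ioo r t) = g.measure.restrict (Ioo r t) := by
  rw [measureOn, Measure.restrict_restrict measurableSet_Ioo, inter_eq_left.2]
  exact fun x hx => ⟨hr.trans hx.1.le, hx.2.trans_le ht⟩

theorem measureOn_real_Ico {r t : ℝ} (hr : 0 ≤ r) (hrt : r ≤ t) (ht : t ≤ T) :
    (g.measureOn T).real (Ico r t) = g t - g r := by
  rw [measureReal_def, measureOn, Measure.restrict_apply measurableSet_Ico, inter_eq_left.2,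
    measure_Ico, ENNReal.toReal_ofReal (sub_nonneg.2 (g.mono hrt))]
  exact fun x hx => ⟨hr.trans hx.1, hx.2.trans_le ht⟩

theorem measureOn_real_Ioo {r t : ℝ} (hr : 0 ≤ r) (hrt : r < t) (ht : t ≤ T) :
    (g.measureOn T).real (Ioo r t) = g t - g r - g.jump r := by
  rw [← measureOn_real_Ico hr hrt.le ht, ← measureOn_real_singleton ⟨hr, hrt.trans_le ht⟩,
    ← Ioo_union_left hrt, measureReal_union (by simp) (measurableSet_singleton r)]
  ring

/-- Local constancy gives a zero right derivative on `[a, b)`; left-continuity extends the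
conclusion to `b`. -/
theorem constant_on_of_subset_C {a b : ℝ} (hab : Ico a b ⊆ g.C) {x : ℝ} (hx : x ∈ Icc a b) :
    g x = g a := by
  have hloc : ∀ y ∈ Ico a b, g =ᶠ[𝓝 y] fun _ => g y := by
    intro y hy
    obtain ⟨ε, hε, h⟩ := hab hy
    filter_upwards [Ioo_mem_nhds (sub_lt_self y hε) (lt_add_of_pos_right y hε)] with s hs using h s hs
  refine constant_of_has_deriv_right_zero (fun y hy => ?_) (fun y hy => ?_) x hx
  · rcases hy.2.lt_or_eq with h | h
    · exact ((continuousAt_const.congr (hloc y ⟨hy.1, h⟩).symm)).continuousWithinAt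
    · rw [h]
      exact (g.leftCont b).mono Icc_subset_Iic_self
  · exact ((hasDerivAt_const y (g y)).congr_of_eventuallyEq (hloc y hy)).hasDerivWithinAt

theorem mem_C_of_constant {a b x c : ℝ} (hx : x ∈ Ioo a b) (h : ∀ s ∈ Ioo a b, g s = c) :
    x ∈ g.C := by
  refine ⟨min (x - a) (b - x), lt_min (sub_pos.2 hx.1) (sub_pos.2 hx.2), fun s hs => ?_⟩
  rw [h s ⟨?_, ?_⟩, h x hx]
  · linarith [hs.1, min_le_left (x - a) (b - x)]
  · linarith [hs.2, min_le_right (x - a) (b - x)]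

/-- The standing assumptions on the interval `[0, T]`. -/
structure Admissible (g : Derivator) (T : ℝ) : Prop where
  pos : 0 < T
  zero_notMem : (0 : ℝ) ∉ g.Nminus
  end_notMem : T ∉ g.Nplus ∪ g.D ∪ g.C

namespace Admissible

variable (hg : g.Admissible T)
include hg

/-- `T ∉ C_g` bounds the component by `T`. A component ending exactly at `T` would put `T` in
`N_g⁺`, since `T ∉ D_g`. If `g` stayed constant beyond the endpoint, the component could be
enlarged. -/
theorem rightEnd_spec {t : ℝ} (ht : t ∈ Icc 0 T) (htC : t ∈ g.C) :
    t < g.rightEnd t ∧ g.rightEnd t < T ∧ g (g.rightEnd t) = g t ∧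
      ∀ s > g.rightEnd t, g (g.rightEnd t) < g s := by
  have hTC : T ∉ g.C := fun h => hg.end_notMem (Or.inr h)
  have hTD : T ∉ g.D := fun h => hg.end_notMem (Or.inl (Or.inr h))
  have hTN : T ∉ g.Nplus := fun h => hg.end_notMem (Or.inl (Or.inl h))
  set S : Set ℝ := {b | Ico t b ⊆ g.C} with hS
  have hne : S.Nonempty := ⟨t, by simp [hS]⟩
  have hbd : ∀ b ∈ S, b ≤ T := by
    intro b hb
    by_contra! h
    exact hTC (hb ⟨ht.2, h⟩)
  have hbdd : BddAbove S := ⟨T, hbd⟩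
  have hdef : g.rightEnd t = sSup S := rfl
  set b := g.rightEnd t with hb
  have hsub : Ico t b ⊆ g.C := by
    intro x hx
    obtain ⟨b', hb', hx'⟩ := exists_lt_of_lt_csSup hne (hdef ▸ hx.2)
    exact hb' ⟨hx.1, hx'⟩
  have htb : t < b := by
    obtain ⟨ε, hε, h⟩ := htC
    have : t + ε ∈ S := fun x hx =>
      mem_C_of_constant (a := t - ε) (b := t + ε) ⟨by linarith [hx.1], hx.2⟩ h
    have := le_csSup hbdd this
    rw [← hdef] at this
    linarith
  have hbT : b ≤ T := hdef ▸ csSup_le hne hbd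
  have hconst : ∀ x ∈ Icc t b, g x = g t := fun x hx => constant_on_of_subset_C hsub hx
  have hgb : g b = g t := hconst b ⟨htb.le, le_rfl⟩
  have hlt : b < T := by
    refine lt_of_le_of_ne hbT fun h => hTN ⟨⟨hTC, t, h ▸ htb, ?_⟩, hTD⟩
    rw [← h]
    exact Ioo_subset_Ico_self.trans hsub
  refine ⟨htb, hlt, hgb, fun s hs => lt_of_le_of_ne (g.mono hs.le) fun h => ?_⟩
  have hmem : s ∈ S := by
    intro x hx
    rcases lt_or_ge x b with h1 | h1
    · exact hsub ⟨hx.1, h1⟩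
    · refine mem_C_of_constant (a := t) (b := s) (c := g b) ⟨htb.trans_le h1, hx.2⟩ fun r hr => ?_
      exact le_antisymm (h ▸ g.mono hr.2.le) (hgb ▸ g.mono hr.1.le)
  have := le_csSup hbdd hmem
  rw [← hdef] at this
  exact absurd hs (not_lt.2 this)

theorem gBase_lt {t : ℝ} (ht : t ∈ Icc 0 T) (h : t ∈ g.C ∪ g.D) :
    gBase g t < T ∧ ∀ s > gBase g t, g (gBase g t) < g s := by
  by_cases htC : t ∈ g.C
  · rw [gBase, if_pos htC]
    exact (hg.rightEnd_spec ht htC).2.2.1 ▸ ⟨(hg.rightEnd_spec ht htC).2.1,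
      (hg.rightEnd_spec ht htC).2.2.1 ▸ (hg.rightEnd_spec ht htC).2.2.2⟩
  · have htD : t ∈ g.D := h.resolve_left htC
    rw [gBase, if_neg htC]
    refine ⟨lt_of_le_of_ne ht.2 fun h => hg.end_notMem (Or.inl (Or.inr (h ▸ htD))), fun s hs => ?_⟩
    have h1 := g.add_jump_le hs
    have h2 : 0 < g.jump t := htD
    linarith

theorem gBase_mem {t : ℝ} (ht : t ∈ Icc 0 T) : gBase g t ∈ Icc 0 T := by
  by_cases htC : t ∈ g.C
  · rw [gBase, if_pos htC]
    have h := hg.rightEnd_spec ht htC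
    exact ⟨ht.1.trans h.1.le, h.2.1.le⟩
  · rwa [gBase, if_neg htC]

theorem apply_gBase {t : ℝ} (ht : t ∈ Icc 0 T) : g (gBase g t) = g t := by
  by_cases htC : t ∈ g.C
  · rw [gBase, if_pos htC, (hg.rightEnd_spec ht htC).2.2.1]
  · rw [gBase, if_neg htC]

/-- Nontriviality makes the `g`-derivative unique. Off `C_g ∪ D_g`, a trivial filter would mean that
`g` is constant on `[0, T]` near `t`; then `t` lies in `C_g` if interior, in `N_g⁻` if `t = 0`, in
`N_g⁺` if `t = T`. -/
theorem gFilter_neBot {t : ℝ} (ht : t ∈ Icc 0 T) : (gFilter g T t).NeBot := by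
  by_cases h : t ∈ g.C ∪ g.D
  · rw [gFilter, if_pos h, nhdsWithin_Ioc_eq_nhdsGT (hg.gBase_lt ht h).1]
    infer_instance
  · rw [gFilter, if_neg h, ← mem_closure_iff_nhdsWithin_neBot, Metric.mem_closure_iff]
    have htC : t ∉ g.C := fun h' => h (Or.inl h')
    have htD : t ∉ g.D := fun h' => h (Or.inr h')
    intro ε hε
    by_contra! hcon
    have hc : ∀ s ∈ Icc 0 T, |t - s| < ε → g s = g t := by
      intro s hs hts
      by_contra hne
      exact absurd hts (not_lt.2 (hcon s ⟨hs, hne⟩))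
    have hT := hg.pos
    rcases ht.1.eq_or_lt with h0 | h0
    · subst h0
      refine hg.zero_notMem ⟨⟨htC, min ε T, lt_min hε hT, fun x hx => ?_⟩, htD⟩
      refine mem_C_of_constant hx fun s hs => hc s ⟨hs.1.le, ?_⟩ ?_
      · exact hs.2.le.trans (min_le_right _ _)
      · rw [zero_sub, abs_neg, abs_of_pos hs.1]
        exact hs.2.trans_le (min_le_left _ _)
    rcases ht.2.eq_or_lt with h1 | h1
    · subst h1
      refine hg.end_notMem (Or.inl (Or.inl ⟨⟨htC, max (t - ε) 0, max_lt (by linarith) hT,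
        fun x hx => ?_⟩, htD⟩))
      refine mem_C_of_constant hx fun s hs => hc s ⟨(le_max_right _ _).trans hs.1.le, hs.2.le⟩ ?_
      rw [abs_of_pos (by linarith [hs.2])]
      linarith [hs.1, le_max_left (t - ε) 0]
    · refine htC (mem_C_of_constant (a := max (t - ε) 0) (b := min (t + ε) T) (c := g t)
        ⟨max_lt (by linarith) h0, lt_min (by linarith) h1⟩ fun s hs => hc s
        ⟨(le_max_right _ _).trans hs.1.le, hs.2.le.trans (min_le_right _ _)⟩ ?_)
      rw [abs_lt]
      constructor
      · linarith [hs.2, min_le_left (t + ε) T]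
      · linarith [hs.1, le_max_left (t - ε) 0]

theorem eventually_gFilter {t : ℝ} (ht : t ∈ Icc 0 T) :
    ∀ᶠ s in gFilter g T t, s ∈ Icc 0 T ∧ g s ≠ g (gBase g t) := by
  by_cases h : t ∈ g.C ∪ g.D
  · rw [gFilter, if_pos h]
    filter_upwards [self_mem_nhdsWithin] with s hs
    exact ⟨⟨(hg.gBase_mem ht).1.trans hs.1.le, hs.2⟩, ((hg.gBase_lt ht h).2 s hs.1).ne'⟩
  · rw [gFilter, if_neg h, hg.apply_gBase ht]
    exact self_mem_nhdsWithin

theorem gFilter_le {t : ℝ} (ht : t ∈ Icc 0 T) : gFilter g T t ≤ 𝓝[≠] (gBase g t) := by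
  have h1 : gFilter g T t ≤ 𝓝 (gBase g t) := by
    by_cases h : t ∈ g.C ∪ g.D
    · rw [gFilter, if_pos h]
      exact nhdsWithin_le_nhds
    · rw [gFilter, if_neg h, gBase, if_neg fun h' => h (Or.inl h')]
      exact nhdsWithin_le_nhds
  refine le_inf h1 (le_principal_iff.2 ?_)
  filter_upwards [hg.eventually_gFilter ht] with s hs h
  exact hs.2 (by rw [mem_singleton_iff.1 h])

end Admissible

end Derivator

/-! ### `g`-continuity and the two halves of the fundamental theorem of calculus. -/

section Spaces

variable {𝕜 : Type*} [RCLike 𝕜] {g : Derivator} {T : ℝ}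

theorem GContinuousOn.eq_of_eq {f : ℝ → 𝕜} (hf : GContinuousOn g T f) {s t : ℝ}
    (hs : s ∈ Icc 0 T) (ht : t ∈ Icc 0 T) (h : g s = g t) : f s = f t := by
  rw [← sub_eq_zero, ← norm_le_zero_iff]
  refine le_of_forall_pos_le_add fun ε hε => ?_
  obtain ⟨δ, hδ, hd⟩ := hf s hs ε hε
  rw [zero_add]
  exact (hd t ht (by simpa [h] using hδ)).le

theorem GContinuousOn.tendsto_left {f : ℝ → 𝕜} (hf : GContinuousOn g T f) {t : ℝ}
    (ht : t ∈ Ioc 0 T) : Tendsto f (𝓝[<] t) (𝓝 (f t)) := by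
  rw [Metric.tendsto_nhds]
  intro ε hε
  obtain ⟨δ, hδ, hd⟩ := hf t ⟨ht.1.le, ht.2⟩ ε hε
  filter_upwards [(Metric.tendsto_nhds.1 (g.tendsto_left t)) δ hδ, self_mem_nhdsWithin,
    Ioo_mem_nhdsLT ht.1] with s h1 h2 h3
  rw [dist_comm, dist_eq_norm]
  refine hd s ⟨h3.1.le, h3.2.le.trans ht.2⟩ ?_
  rwa [dist_comm, Real.dist_eq] at h1

/-- A `g`-continuous function takes equal values where `g` does, so it factors as `ψ ∘ g` with `ψ`
continuous on `g([0, T])`. -/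
theorem GContinuousOn.aestronglyMeasurable {f : ℝ → 𝕜} (hf : GContinuousOn g T f) :
    AEStronglyMeasurable f (g.measureOn T) := by
  let A : Set ℝ := g '' Icc 0 T
  let ψ : A → 𝕜 := fun a => f a.2.choose
  have hψ : Continuous ψ := by
    refine Metric.continuous_iff.2 fun a ε hε => ?_
    obtain ⟨δ, hδ, hd⟩ := hf _ a.2.choose_spec.1 ε hε
    refine ⟨δ, hδ, fun b hb => ?_⟩
    rw [dist_comm, dist_eq_norm]
    refine hd _ b.2.choose_spec.1 ?_
    rw [a.2.choose_spec.2, b.2.choose_spec.2]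
    rwa [dist_comm, Subtype.dist_eq, Real.dist_eq] at hb
  let γ : Icc (0 : ℝ) T → A := fun t => ⟨g t, mem_image_of_mem _ t.2⟩
  have hγ : Measurable γ := (g.mono.measurable.comp measurable_subtype_coe).subtype_mk
  have hfg : (fun t : Icc (0 : ℝ) T => f t) = ψ ∘ γ := by
    funext t
    exact hf.eq_of_eq t.2 (γ t).2.choose_spec.1 (γ t).2.choose_spec.2.symm
  have h1 : AEMeasurable f (g.measure.restrict (Icc 0 T)) :=
    aemeasurable_restrict_of_measurable_subtype measurableSet_Icc (hfg ▸ hψ.measurable.comp hγ)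
  exact (h1.mono_measure (Measure.restrict_mono Ico_subset_Icc_self le_rfl)).aestronglyMeasurable

theorem GContinuousOn.integrable {f : ℝ → 𝕜} (hf : GContinuousOn g T f) {M : ℝ}
    (hM : ∀ t ∈ Icc 0 T, ‖f t‖ ≤ M) : Integrable f (g.measureOn T) := by
  refine (integrable_const M).mono' hf.aestronglyMeasurable ?_
  filter_upwards [Derivator.ae_mem_Icc] with t ht using hM t ht

namespace IsPrimitive

variable {F φ : ℝ → 𝕜} {c : 𝕜}

theorem sub_eq (h : IsPrimitive (g.measureOn T) (Icc 0 T) c F φ) {s t : ℝ} (hs : 0 ≤ s)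
    (hst : s ≤ t) (ht : t ≤ T) : F t - F s = ∫ r in Ico s t, φ r ∂g.measureOn T := by
  rw [h.eq t ⟨hs.trans hst, ht⟩, h.eq s ⟨hs, hst.trans ht⟩, ← Iio_union_Ico_eq_Iio hst,
    setIntegral_union _ measurableSet_Ico h.integrable.integrableOn h.integrable.integrableOn]
  · abel
  · exact Set.disjoint_left.2 fun a ha hb => absurd hb.1 (not_le.2 ha)

theorem sub_sub_eq (h : IsPrimitive (g.measureOn T) (Icc 0 T) c F φ) {s t : ℝ} (hs : 0 ≤ s)
    (hst : s ≤ t) (ht : t ≤ T) (a : 𝕜) :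
    F t - F s - ((g t - g s : ℝ) : 𝕜) * a = ∫ r in Ico s t, (φ r - a) ∂g.measureOn T := by
  rw [integral_sub h.integrable.integrableOn (integrable_const a).integrableOn,
    ← h.sub_eq hs hst ht, setIntegral_const, Derivator.measureOn_real_Ico hs hst ht,
    RCLike.real_smul_eq_coe_mul]

theorem gContinuousOn (h : IsPrimitive (g.measureOn T) (Icc 0 T) c F φ) {M : ℝ}
    (hM : ∀ t ∈ Icc 0 T, ‖φ t‖ ≤ M) : GContinuousOn g T F := by
  have key : ∀ s ∈ Icc 0 T, ∀ t ∈ Icc 0 T, s ≤ t → ‖F t - F s‖ ≤ M * |g t - g s| := by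
    intro s hs t ht hst
    rw [h.sub_eq hs.1 hst ht.2, abs_of_nonneg (sub_nonneg.2 (g.mono hst)),
      ← Derivator.measureOn_real_Ico hs.1 hst ht.2]
    exact norm_setIntegral_le_of_norm_le_const (measure_lt_top _ _) fun x hx =>
      hM x ⟨hs.1.trans hx.1, hx.2.le.trans ht.2⟩
  intro t ht ε hε
  have hM0 : 0 ≤ M := (norm_nonneg _).trans (hM t ht)
  refine ⟨ε / (M + 1), by positivity, fun s hs hst => ?_⟩
  have h1 : ‖F t - F s‖ ≤ M * |g t - g s| := by
    rcases le_total s t with h2 | h2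
    · exact key s hs t ht h2
    · rw [norm_sub_rev, abs_sub_comm]
      exact key t ht s hs h2
  rw [lt_div_iff₀ (by positivity)] at hst
  nlinarith [abs_nonneg (g t - g s)]

/-- At a jump, `φ - φ b` vanishes at the atom `b`, while `(b, s)` has mass tending to `0` and `g s -
g b` is at least the jump. Elsewhere `g` is right-continuous and `φ` is close to `φ b` on `[b, s)`.
The product form avoids dividing by a possibly zero increment. -/
theorem eventually_right (h : IsPrimitive (g.measureOn T) (Icc 0 T) c F φ)
    (hφ : GContinuousOn g T φ) {M : ℝ} (hM : ∀ t ∈ Icc 0 T, ‖φ t‖ ≤ M) {b : ℝ}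
    (hb : b ∈ Icc 0 T) {ε : ℝ} (hε : 0 < ε) :
    ∀ᶠ s in 𝓝[>] b, s ≤ T →
      ‖F s - F b - ((g s - g b : ℝ) : 𝕜) * φ b‖ ≤ ε * |g s - g b| := by
  by_cases hD : b ∈ g.D
  · have hj : 0 < g.jump b := hD
    have h1 : Tendsto (fun s => (M + M) * (g s - g b - g.jump b)) (𝓝[>] b) (𝓝 0) := by
      have := (((g.tendsto_right b).sub_const (g b)).sub_const (g.jump b)).const_mul (M + M)
      simpa using this
    filter_upwards [h1.eventually_lt_const (mul_pos hε hj), self_mem_nhdsWithin] with s hs hbs hsT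
    have hbs' : b < s := hbs
    rw [h.sub_sub_eq hb.1 hbs'.le hsT, abs_of_nonneg (sub_nonneg.2 (g.mono hbs'.le)),
      ← Ioo_union_left hbs', setIntegral_union (by simp) (measurableSet_singleton b),
      integral_singleton, sub_self, smul_zero, add_zero]
    · have h2 : ‖∫ r in Ioo b s, (φ r - φ b) ∂g.measureOn T‖ ≤
          (M + M) * (g.measureOn T).real (Ioo b s) :=
        norm_setIntegral_le_of_norm_le_const (measure_lt_top _ _) fun x hx =>
          (norm_sub_le _ _).trans (add_le_add
            (hM x ⟨hb.1.trans hx.1.le, hx.2.le.trans hsT⟩) (hM b hb))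
      rw [Derivator.measureOn_real_Ioo hb.1 hbs' hsT] at h2
      have h3 := g.add_jump_le hbs'
      have h4 : ε * g.jump b ≤ ε * (g s - g b) := mul_le_mul_of_nonneg_left (by linarith) hε.le
      linarith
    · exact (h.integrable.sub (integrable_const _)).integrableOn
    · exact (h.integrable.sub (integrable_const _)).integrableOn
  · obtain ⟨δ, hδ, hd⟩ := hφ b hb ε hε
    filter_upwards [(g.tendsto_right_of_notMem hD).eventually_lt_const (lt_add_of_pos_right _ hδ),
      self_mem_nhdsWithin] with s hs hbs hsT
    have hbs' : b < s := hbs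
    rw [h.sub_sub_eq hb.1 hbs'.le hsT, abs_of_nonneg (sub_nonneg.2 (g.mono hbs'.le)),
      ← Derivator.measureOn_real_Ico hb.1 hbs'.le hsT]
    refine norm_setIntegral_le_of_norm_le_const (measure_lt_top _ _) fun x hx => ?_
    rw [norm_sub_rev]
    refine (hd x ⟨hb.1.trans hx.1, hx.2.le.trans hsT⟩ ?_).le
    rw [abs_sub_comm, abs_of_nonneg (sub_nonneg.2 (g.mono hx.1))]
    linarith [g.mono hx.2.le]

theorem eventually_left (h : IsPrimitive (g.measureOn T) (Icc 0 T) c F φ)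
    (hφ : GContinuousOn g T φ) {b : ℝ} (hb : b ∈ Icc 0 T) {ε : ℝ} (hε : 0 < ε) :
    ∀ᶠ s in 𝓝[<] b, 0 ≤ s →
      ‖F s - F b - ((g s - g b : ℝ) : 𝕜) * φ b‖ ≤ ε * |g s - g b| := by
  obtain ⟨δ, hδ, hd⟩ := hφ b hb ε hε
  filter_upwards [(g.tendsto_left b).eventually_const_lt (sub_lt_self _ hδ),
    self_mem_nhdsWithin] with s hs hbs hs0
  have hbs' : s < b := hbs
  have h1 : F s - F b - ((g s - g b : ℝ) : 𝕜) * φ b =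
      -(F b - F s - ((g b - g s : ℝ) : 𝕜) * φ b) := by
    push_cast
    ring
  rw [h1, norm_neg, h.sub_sub_eq hs0 hbs'.le hb.2, abs_sub_comm,
    abs_of_nonneg (sub_nonneg.2 (g.mono hbs'.le)),
    ← Derivator.measureOn_real_Ico hs0 hbs'.le hb.2]
  refine norm_setIntegral_le_of_norm_le_const (measure_lt_top _ _) fun x hx => ?_
  rw [norm_sub_rev]
  refine (hd x ⟨hs0.trans hx.1, hx.2.le.trans hb.2⟩ ?_).le
  rw [abs_of_nonneg (sub_nonneg.2 (g.mono hx.2.le))]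
  linarith [g.mono hx.1]

/-- The one-sided estimates are applied at the base point `b` of `t`; `g b = g t` forces `φ b = φ
t`. -/
theorem tendsto_gQuotient (hg : g.Admissible T)
    (h : IsPrimitive (g.measureOn T) (Icc 0 T) c F φ)
    (hφ : GContinuousOn g T φ) {M : ℝ} (hM : ∀ t ∈ Icc 0 T, ‖φ t‖ ≤ M) {t : ℝ}
    (ht : t ∈ Icc 0 T) : Tendsto (gQuotient g F t) (gFilter g T t) (𝓝 (φ t)) := by
  have hb := hg.gBase_mem ht
  rw [← hφ.eq_of_eq hb ht (hg.apply_gBase ht), Metric.tendsto_nhds]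
  intro ε hε
  set b := gBase g t
  have key : ∀ᶠ s in 𝓝[≠] b, s ∈ Icc 0 T →
      ‖F s - F b - ((g s - g b : ℝ) : 𝕜) * φ b‖ ≤ ε / 2 * |g s - g b| := by
    rw [← nhdsLT_sup_nhdsGT, eventually_sup]
    exact ⟨(h.eventually_left hφ hb (half_pos hε)).mono fun s hs hs' => hs hs'.1,
      (h.eventually_right hφ hM hb (half_pos hε)).mono fun s hs hs' => hs hs'.2⟩
  filter_upwards [hg.gFilter_le ht key, hg.eventually_gFilter ht] with s h1 h2
  have hne : ((g s - g b : ℝ) : 𝕜) ≠ 0 := RCLike.ofReal_ne_zero.2 (sub_ne_zero.2 h2.2)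
  have hpos : 0 < |g s - g b| := abs_pos.2 (sub_ne_zero.2 h2.2)
  have h3 : gQuotient g F t s - φ b =
      (F s - F b - ((g s - g b : ℝ) : 𝕜) * φ b) / ((g s - g b : ℝ) : 𝕜) := by
    rw [gQuotient, sub_div _ (((g s - g b : ℝ) : 𝕜) * φ b), mul_div_cancel_left₀ _ hne]
  rw [dist_eq_norm, h3, norm_div, RCLike.norm_ofReal, div_lt_iff₀ hpos]
  exact (h1 h2.1).trans_lt (mul_lt_mul_of_pos_right (half_lt_self hε) hpos)

end IsPrimitive

/-- A `g`-continuous function with vanishing `g`-derivative is constant. -/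
theorem GContinuousOn.eq_of_tendsto_gQuotient_zero {u : ℝ → 𝕜}
    (hu : GContinuousOn g T u)
    (h : ∀ t ∈ Icc 0 T, Tendsto (gQuotient g u t) (gFilter g T t) (𝓝 0)) {t : ℝ}
    (ht : t ∈ Icc 0 T) : u t = u 0 := by
  -- Continuous induction along `[0, T]`: the set of good `t` is closed because `u` and `g` are
  -- left-continuous, and it extends to the right of each of its points.
  have main : ∀ ε > 0, ∀ t ∈ Icc 0 T, ‖u t - u 0‖ ≤ ε * (g t - g 0) := by
    intro ε hε
    set S : Set ℝ := {t | ∀ r ∈ Icc 0 t, ‖u r - u 0‖ ≤ ε * (g r - g 0)} with hS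
    have hclosed : IsClosed (S ∩ Icc 0 T) := by
      refine isClosed_of_closure_subset fun t htc => ?_
      have htI : t ∈ Icc 0 T := closure_minimal inter_subset_right isClosed_Icc htc
      refine ⟨fun r hr => ?_, htI⟩
      have hlt : ∀ r, 0 ≤ r → r < t → ‖u r - u 0‖ ≤ ε * (g r - g 0) := by
        intro r hr0 hrt
        obtain ⟨s, hs1, hs2⟩ := mem_closure_iff.1 htc (Ioi r) isOpen_Ioi hrt
        exact hs2.1 r ⟨hr0, hs1.le⟩
      rcases hr.2.lt_or_eq with hrt | hrt
      · exact hlt r hr.1 hrt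
      · subst hrt
        rcases hr.1.eq_or_lt with h0 | h0
        · simp [← h0]
        · refine le_of_tendsto_of_tendsto
            ((hu.tendsto_left ⟨h0, htI.2⟩).sub_const (u 0)).norm
            (((g.tendsto_left r).sub_const (g 0)).const_mul ε) ?_
          filter_upwards [Ioo_mem_nhdsLT h0] with s hs using hlt s hs.1.le hs.2
    have hext : ∀ x ∈ S ∩ Ico 0 T, ∀ y ∈ Ioi x, (S ∩ Ioc x y).Nonempty := by
      rintro x ⟨hxS, hx⟩ y hy
      have hxI : x ∈ Icc 0 T := Ico_subset_Icc_self hx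
      -- Either `g s = g x`, and then `u s = u x`, or the difference quotient at `x` is smaller than
      -- `ε`. For `x ∈ C_g` only the first case occurs near `x`, so the derivative based at the far
      -- endpoint is not needed.
      have hev : ∀ᶠ s in 𝓝[>] x, s ≤ T → ‖u s - u x‖ ≤ ε * (g s - g x) := by
        have heq : ∀ s, x < s → s ≤ T → g s = g x → ‖u s - u x‖ ≤ ε * (g s - g x) := by
          intro s hs hsT hgs
          rw [hu.eq_of_eq ⟨hx.1.trans hs.le, hsT⟩ hxI hgs, hgs]
          simp
        have hquot : x ∉ g.C → ∀ s, x < s → g s ≠ g x → dist (gQuotient g u x s) 0 < ε →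
            ‖u s - u x‖ ≤ ε * (g s - g x) := by
          intro hxC s hs hgs hd
          have hpos : 0 < g s - g x := sub_pos.2 (lt_of_le_of_ne (g.mono hs.le) hgs.symm)
          rw [gQuotient, gBase, if_neg hxC, dist_zero_right, norm_div, RCLike.norm_ofReal,
            abs_of_pos hpos, div_lt_iff₀ hpos] at hd
          exact hd.le
        by_cases hxC : x ∈ g.C
        · obtain ⟨δ, hδ, hd⟩ := hxC
          filter_upwards [Ioo_mem_nhdsGT (lt_add_of_pos_right x hδ)] with s hs hsT
          exact heq s hs.1 hsT (hd s ⟨by linarith [hs.1], hs.2⟩)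
        · have hq := Metric.tendsto_nhds.1 (h x hxI) ε hε
          by_cases hxD : x ∈ g.D
          · rw [gFilter, if_pos (show x ∈ g.C ∪ g.D from Or.inr hxD), gBase, if_neg hxC, eventually_nhdsWithin_iff] at hq
            filter_upwards [mem_nhdsWithin_of_mem_nhds hq, self_mem_nhdsWithin] with s hs hxs hsT
            by_cases hgs : g s = g x
            · exact heq s hxs hsT hgs
            · exact hquot hxC s hxs hgs (hs ⟨hxs, hsT⟩)
          · rw [gFilter, if_neg (by simp [hxC, hxD]), eventually_nhdsWithin_iff] at hq
            filter_upwards [mem_nhdsWithin_of_mem_nhds hq, self_mem_nhdsWithin] with s hs hxs hsT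
            by_cases hgs : g s = g x
            · exact heq s hxs hsT hgs
            · exact hquot hxC s hxs hgs (hs ⟨⟨hx.1.trans (le_of_lt hxs), hsT⟩, hgs⟩)
      obtain ⟨z, hz, hsub⟩ := mem_nhdsGT_iff_exists_Ioc_subset.1 hev
      have hz' : x < z := hz
      have hy' : x < y := hy
      refine ⟨min z (min y T), fun r hr => ?_, lt_min hz' (lt_min hy' hx.2),
        (min_le_right _ _).trans (min_le_left _ _)⟩
      rcases le_or_gt r x with hrx | hrx
      · exact hxS r ⟨hr.1, hrx⟩
      · have h1 := hsub ⟨hrx, hr.2.trans (min_le_left _ _)⟩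
          (hr.2.trans ((min_le_right _ _).trans (min_le_right _ _)))
        have h2 := hxS x ⟨hx.1, le_rfl⟩
        calc ‖u r - u 0‖ ≤ ‖u r - u x‖ + ‖u x - u 0‖ := norm_sub_le_norm_sub_add_norm_sub _ _ _
          _ ≤ ε * (g r - g x) + ε * (g x - g 0) := add_le_add h1 h2
          _ = ε * (g r - g 0) := by ring
    have h0S : (0 : ℝ) ∈ S := by
      intro r hr
      rw [le_antisymm hr.2 hr.1]
      simp
    intro t ht
    exact hclosed.Icc_subset_of_forall_exists_gt h0S hext ht t ⟨ht.1, le_rfl⟩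
  rw [← sub_eq_zero, ← norm_le_zero_iff]
  refine le_of_forall_pos_le_add fun ε hε => ?_
  have hgt : 0 ≤ g t - g 0 := sub_nonneg.2 (g.mono ht.1)
  have h1 := main (ε / (g t - g 0 + 1)) (by positivity) t ht
  refine h1.trans ?_
  rw [zero_add, div_mul_eq_mul_div, div_le_iff₀ (by positivity)]
  nlinarith

end Spaces

/-! ### Linearity of the `g`-derivative, the spaces `BC_g^k`, and regularity of solutions. -/

section Spaces

variable {𝕜 : Type*} [RCLike 𝕜] {g : Derivator} {T : ℝ}

theorem gQuotient_add (f h : ℝ → 𝕜) (t : ℝ) :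
    gQuotient g (fun s => f s + h s) t = fun s => gQuotient g f t s + gQuotient g h t s := by
  funext s
  simp only [gQuotient]
  rw [← add_div]
  ring_nf

theorem gQuotient_const_mul (a : 𝕜) (f : ℝ → 𝕜) (t : ℝ) :
    gQuotient g (fun s => a * f s) t = fun s => a * gQuotient g f t s := by
  funext s
  simp only [gQuotient]
  rw [← mul_div_assoc, mul_sub]

namespace Derivator.Admissible

variable (hg : g.Admissible T) {f h : ℝ → 𝕜} {t : ℝ}
include hg

theorem eventuallyEq_gQuotient (hfh : EqOn f h (Icc 0 T)) (ht : t ∈ Icc 0 T) :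
    gQuotient g f t =ᶠ[gFilter g T t] gQuotient g h t := by
  filter_upwards [hg.eventually_gFilter ht] with s hs
  rw [gQuotient, gQuotient, hfh hs.1, hfh (hg.gBase_mem ht)]

theorem gDeriv_congr (hfh : EqOn f h (Icc 0 T)) : EqOn (gDeriv g T f) (gDeriv g T h) (Icc 0 T) := by
  intro t ht
  rw [gDeriv, gDeriv, limUnder, limUnder, Filter.map_congr (hg.eventuallyEq_gQuotient hfh ht)]

theorem gDifferentiableAt_congr (hfh : EqOn f h (Icc 0 T)) (ht : t ∈ Icc 0 T)
    (hf : GDifferentiableAt g T f t) : GDifferentiableAt g T h t :=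
  hf.imp fun _ hL => hL.congr' (hg.eventuallyEq_gQuotient hfh ht)

theorem gDeriv_eq {L : 𝕜} (ht : t ∈ Icc 0 T)
    (h : Tendsto (gQuotient g f t) (gFilter g T t) (𝓝 L)) : gDeriv g T f t = L :=
  haveI := hg.gFilter_neBot ht
  h.limUnder_eq

theorem gDeriv_add (hf : ∀ t ∈ Icc 0 T, GDifferentiableAt g T f t)
    (hh : ∀ t ∈ Icc 0 T, GDifferentiableAt g T h t) :
    EqOn (gDeriv g T fun s => f s + h s) (fun s => gDeriv g T f s + gDeriv g T h s) (Icc 0 T) := by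
  intro t ht
  refine hg.gDeriv_eq ht ?_
  rw [gQuotient_add]
  exact (tendsto_nhds_limUnder (hf t ht)).add (tendsto_nhds_limUnder (hh t ht))

theorem gDeriv_const_mul (a : 𝕜) (hf : ∀ t ∈ Icc 0 T, GDifferentiableAt g T f t) :
    EqOn (gDeriv g T fun s => a * f s) (fun s => a * gDeriv g T f s) (Icc 0 T) := by
  intro t ht
  refine hg.gDeriv_eq ht ?_
  rw [gQuotient_const_mul]
  exact (tendsto_nhds_limUnder (hf t ht)).const_mul a

end Derivator.Admissible

theorem GDifferentiableAt.add {f h : ℝ → 𝕜} {t : ℝ} (hf : GDifferentiableAt g T f t)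
    (hh : GDifferentiableAt g T h t) : GDifferentiableAt g T (fun s => f s + h s) t := by
  obtain ⟨L, hL⟩ := hf
  obtain ⟨L', hL'⟩ := hh
  exact ⟨L + L', by rw [gQuotient_add]; exact hL.add hL'⟩

theorem GDifferentiableAt.const_mul {f : ℝ → 𝕜} {t : ℝ} (a : 𝕜)
    (hf : GDifferentiableAt g T f t) : GDifferentiableAt g T (fun s => a * f s) t := by
  obtain ⟨L, hL⟩ := hf
  exact ⟨a * L, by rw [gQuotient_const_mul]; exact hL.const_mul a⟩

theorem GContinuousOn.congr {f h : ℝ → 𝕜} (hf : GContinuousOn g T f)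
    (hfh : EqOn f h (Icc 0 T)) : GContinuousOn g T h := by
  intro t ht ε hε
  obtain ⟨δ, hδ, hd⟩ := hf t ht ε hε
  exact ⟨δ, hδ, fun s hs hst => by rw [← hfh ht, ← hfh hs]; exact hd s hs hst⟩

theorem GContinuousOn.add {f h : ℝ → 𝕜} (hf : GContinuousOn g T f) (hh : GContinuousOn g T h) :
    GContinuousOn g T fun s => f s + h s := by
  intro t ht ε hε
  obtain ⟨δ, hδ, hd⟩ := hf t ht (ε / 2) (half_pos hε)
  obtain ⟨δ', hδ', hd'⟩ := hh t ht (ε / 2) (half_pos hε)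
  refine ⟨min δ δ', lt_min hδ hδ', fun s hs hst => ?_⟩
  have h1 := hd s hs (hst.trans_le (min_le_left _ _))
  have h2 := hd' s hs (hst.trans_le (min_le_right _ _))
  rw [add_sub_add_comm]
  exact (norm_add_le _ _).trans_lt (by linarith)

theorem GContinuousOn.const_mul {f : ℝ → 𝕜} (hf : GContinuousOn g T f) (a : 𝕜) :
    GContinuousOn g T fun s => a * f s := by
  intro t ht ε hε
  obtain ⟨δ, hδ, hd⟩ := hf t ht (ε / (‖a‖ + 1)) (by positivity)
  refine ⟨δ, hδ, fun s hs hst => ?_⟩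
  have h1 := hd s hs hst
  rw [lt_div_iff₀ (by positivity)] at h1
  rw [← mul_sub, norm_mul]
  nlinarith [norm_nonneg (f t - f s), norm_nonneg a]

theorem memBC_zero {f : ℝ → 𝕜} :
    MemBC g T 0 f ↔ GContinuousOn g T f ∧ ∃ M : ℝ, ∀ t ∈ Icc 0 T, ‖f t‖ ≤ M := by
  constructor
  · intro h
    exact ⟨h.1.2 0 le_rfl, h.2 0 le_rfl⟩
  · intro h
    refine ⟨⟨fun j hj => absurd hj (Nat.not_lt_zero j), fun j hj => ?_⟩, fun j hj => ?_⟩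
    · rw [Nat.le_zero.1 hj]
      exact h.1
    · rw [Nat.le_zero.1 hj]
      exact h.2

theorem memBC_succ {f : ℝ → 𝕜} {k : ℕ} :
    MemBC g T (k + 1) f ↔ (∀ t ∈ Icc 0 T, GDifferentiableAt g T f t) ∧ MemBC g T 0 f ∧
      MemBC g T k (gDeriv g T f) := by
  rw [memBC_zero]
  constructor
  · intro h
    exact ⟨h.1.1 0 k.succ_pos, ⟨h.1.2 0 (Nat.zero_le _), h.2 0 (Nat.zero_le _)⟩,
      ⟨fun j hj => h.1.1 (j + 1) (Nat.succ_lt_succ hj),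
        fun j hj => h.1.2 (j + 1) (Nat.succ_le_succ hj)⟩,
      fun j hj => h.2 (j + 1) (Nat.succ_le_succ hj)⟩
  · rintro ⟨h1, ⟨h2, h3⟩, h4⟩
    refine ⟨⟨fun j hj => ?_, fun j hj => ?_⟩, fun j hj => ?_⟩
    · cases j with
      | zero => exact h1
      | succ j => exact h4.1.1 j (Nat.lt_of_succ_lt_succ hj)
    · cases j with
      | zero => exact h2
      | succ j => exact h4.1.2 j (Nat.le_of_succ_le_succ hj)
    · cases j with
      | zero => exact h3
      | succ j => exact h4.2 j (Nat.le_of_succ_le_succ hj)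

namespace MemBC

theorem mono {f : ℝ → 𝕜} {k l : ℕ} (hf : MemBC g T l f) (hkl : k ≤ l) : MemBC g T k f :=
  ⟨⟨fun j hj => hf.1.1 j (hj.trans_le hkl), fun j hj => hf.1.2 j (hj.trans hkl)⟩,
    fun j hj => hf.2 j (hj.trans hkl)⟩

theorem congr (hg : g.Admissible T) {f h : ℝ → 𝕜} {k : ℕ} (hf : MemBC g T k f)
    (hfh : EqOn f h (Icc 0 T)) : MemBC g T k h := by
  induction k generalizing f h with
  | zero =>
    obtain ⟨h1, M, hM⟩ := memBC_zero.1 hf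
    exact memBC_zero.2 ⟨h1.congr hfh, M, fun t ht => hfh ht ▸ hM t ht⟩
  | succ k ih =>
    obtain ⟨h1, h2, h3⟩ := memBC_succ.1 hf
    obtain ⟨h4, M, hM⟩ := memBC_zero.1 h2
    exact memBC_succ.2 ⟨fun t ht => hg.gDifferentiableAt_congr hfh ht (h1 t ht),
      memBC_zero.2 ⟨h4.congr hfh, M, fun t ht => hfh ht ▸ hM t ht⟩,
      ih h3 (hg.gDeriv_congr hfh)⟩

theorem add (hg : g.Admissible T) {f h : ℝ → 𝕜} {k : ℕ} (hf : MemBC g T k f)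
    (hh : MemBC g T k h) : MemBC g T k fun s => f s + h s := by
  have h0 : ∀ {f h : ℝ → 𝕜}, MemBC g T 0 f → MemBC g T 0 h → MemBC g T 0 fun s => f s + h s := by
    intro f h hf hh
    obtain ⟨h1, M, hM⟩ := memBC_zero.1 hf
    obtain ⟨h2, M', hM'⟩ := memBC_zero.1 hh
    exact memBC_zero.2 ⟨h1.add h2, M + M', fun t ht =>
      (norm_add_le _ _).trans (add_le_add (hM t ht) (hM' t ht))⟩
  induction k generalizing f h with
  | zero => exact h0 hf hh
  | succ k ih =>
    obtain ⟨h1, h2, h3⟩ := memBC_succ.1 hf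
    obtain ⟨h1', h2', h3'⟩ := memBC_succ.1 hh
    exact memBC_succ.2 ⟨fun t ht => (h1 t ht).add (h1' t ht), h0 h2 h2',
      (ih h3 h3').congr hg (hg.gDeriv_add h1 h1').symm⟩

theorem const_mul (hg : g.Admissible T) {f : ℝ → 𝕜} {k : ℕ} (hf : MemBC g T k f) (a : 𝕜) :
    MemBC g T k fun s => a * f s := by
  have h0 : ∀ {f : ℝ → 𝕜}, MemBC g T 0 f → MemBC g T 0 fun s => a * f s := by
    intro f hf
    obtain ⟨h1, M, hM⟩ := memBC_zero.1 hf
    refine memBC_zero.2 ⟨h1.const_mul a, ‖a‖ * M, fun t ht => ?_⟩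
    rw [norm_mul]
    exact mul_le_mul_of_nonneg_left (hM t ht) (norm_nonneg a)
  induction k generalizing f with
  | zero => exact h0 hf
  | succ k ih =>
    obtain ⟨h1, h2, h3⟩ := memBC_succ.1 hf
    exact memBC_succ.2 ⟨fun t ht => (h1 t ht).const_mul a, h0 h2,
      (ih h3).congr hg (hg.gDeriv_const_mul a h1).symm⟩

theorem integrable {f : ℝ → 𝕜} {k : ℕ} (hf : MemBC g T k f) : Integrable f (g.measureOn T) := by
  obtain ⟨h1, M, hM⟩ := memBC_zero.1 (hf.mono (Nat.zero_le _))
  exact h1.integrable hM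

/-- A `BC_g^1` function is the primitive of its `g`-derivative. -/
theorem isPrimitive (hg : g.Admissible T) {w : ℝ → 𝕜} (hw : MemBC g T 1 w) :
    IsPrimitive (g.measureOn T) (Icc 0 T) (w 0) w (gDeriv g T w) := by
  obtain ⟨h1, h2, h3⟩ := memBC_succ.1 hw
  obtain ⟨h4, M, hM⟩ := memBC_zero.1 h3
  have hF := IsPrimitive.of_integrable h3.integrable (Icc 0 T) (w 0)
  set F : ℝ → 𝕜 := fun t => w 0 + ∫ s in Iio t, gDeriv g T w s ∂g.measureOn T with hFdef
  have hF0 : F 0 = w 0 := by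
    rw [hFdef]
    simp only
    rw [Derivator.measureOn_restrict_Iio ⟨le_rfl, hg.pos.le⟩]
    simp
  -- `w - F` has zero `g`-derivative and vanishes at `0`.
  have hu : GContinuousOn g T fun s => w s + (-1) * F s :=
    (memBC_zero.1 h2).1.add ((hF.gContinuousOn hM).const_mul (-1))
  have key := fun t ht => hu.eq_of_tendsto_gQuotient_zero (t := t) (fun t ht => by
    rw [gQuotient_add, gQuotient_const_mul]
    have := (tendsto_nhds_limUnder (h1 t ht)).add
      ((hF.tendsto_gQuotient hg h4 hM ht).const_mul (-1))
    simpa [gDeriv] using this) ht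
  refine hF.congr_fun fun t ht => ?_
  have := key t ht
  rw [hF0] at this
  linear_combination this

end MemBC

/-- A primitive of a `BC_g^k` function is in `BC_g^{k+1}`. -/
theorem IsPrimitive.memBC_succ (hg : g.Admissible T) {F φ : ℝ → 𝕜} {c : 𝕜} {k : ℕ}
    (h : IsPrimitive (g.measureOn T) (Icc 0 T) c F φ) (hφ : MemBC g T k φ) :
    MemBC g T (k + 1) F ∧ EqOn (gDeriv g T F) φ (Icc 0 T) := by
  obtain ⟨h4, M, hM⟩ := memBC_zero.1 (hφ.mono (Nat.zero_le _))
  have heq : EqOn (gDeriv g T F) φ (Icc 0 T) := fun t ht =>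
    hg.gDeriv_eq ht (h.tendsto_gQuotient hg h4 hM ht)
  exact ⟨_root_.memBC_succ.2 ⟨fun t ht => ⟨_, h.tendsto_gQuotient hg h4 hM ht⟩,
    memBC_zero.2 ⟨h.gContinuousOn hM, h.exists_bound⟩, hφ.congr hg heq.symm⟩, heq⟩

/-- An integral form of the second order problem. -/
theorem memBC_of_isPrimitive (hg : g.Admissible T) {P Q x₀ v₀ : 𝕜} {f v v₁ : ℝ → 𝕜} {n : ℕ}
    (hf : MemBC g T n f) (hv : IsPrimitive (g.measureOn T) (Icc 0 T) x₀ v v₁)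
    (hv₁ : IsPrimitive (g.measureOn T) (Icc 0 T) v₀ v₁
      (fun t => f t + ((-P) * v₁ t + (-Q) * v t))) :
    MemBC g T (n + 2) v ∧ IsSolution g T P Q f x₀ v₀ v := by
  have hzero : ∀ {c : 𝕜} {F φ : ℝ → 𝕜}, IsPrimitive (g.measureOn T) (Icc 0 T) c F φ →
      F 0 = c := by
    intro c F φ h
    rw [h.eq 0 ⟨le_rfl, hg.pos.le⟩, Derivator.measureOn_restrict_Iio ⟨le_rfl, hg.pos.le⟩]
    simp
  -- Bootstrap: the density of `v₁` is as regular as `f`, `v` and `v₁`, and integration gains one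
  -- order. It stops at `n`, the regularity of `f`; one further integration gives `v` the order `n +
  -- 2`.
  have hstep : ∀ {k : ℕ}, k ≤ n → MemBC g T k v → MemBC g T k v₁ → MemBC g T (k + 1) v₁ :=
    fun hk h h₁ => (hv₁.memBC_succ hg ((hf.mono hk).add hg
      ((h₁.const_mul hg (-P)).add hg (h.const_mul hg (-Q))))).1
  have hcont : ∀ {c : 𝕜} {F φ : ℝ → 𝕜}, IsPrimitive (g.measureOn T) (Icc 0 T) c F φ →
      (∃ M : ℝ, ∀ t ∈ Icc 0 T, ‖φ t‖ ≤ M) → MemBC g T 0 F := by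
    rintro c F φ h ⟨M, hM⟩
    exact memBC_zero.2 ⟨h.gContinuousOn hM, h.exists_bound⟩
  have hv0 : MemBC g T 0 v := hcont hv hv₁.exists_bound
  have hv₁0 : MemBC g T 0 v₁ := by
    refine hcont hv₁ ?_
    obtain ⟨M₁, hM₁⟩ := hv₁.exists_bound
    obtain ⟨M, hM⟩ := hv.exists_bound
    obtain ⟨M', hM'⟩ := (memBC_zero.1 (hf.mono (Nat.zero_le _))).2
    refine ⟨M' + (‖-P‖ * M₁ + ‖-Q‖ * M), fun t ht => ?_⟩
    refine (norm_add_le _ _).trans (add_le_add (hM' t ht) ((norm_add_le _ _).trans ?_))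
    rw [norm_mul, norm_mul]
    gcongr
    · exact hM₁ t ht
    · exact hM t ht
  have hall : ∀ k, k ≤ n → MemBC g T (k + 1) v₁ ∧ MemBC g T (k + 2) v := by
    intro k
    induction k with
    | zero =>
      intro _
      have h1 := hstep (Nat.zero_le _) hv0 hv₁0
      exact ⟨h1, (hv.memBC_succ hg h1).1⟩
    | succ k ih =>
      intro hk
      obtain ⟨h1, h2⟩ := ih (Nat.le_of_succ_le hk)
      have h3 := hstep hk (h2.mono (by omega)) h1
      exact ⟨h3, (hv.memBC_succ hg h3).1⟩
  obtain ⟨h1, h2⟩ := hall n le_rfl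
  have hd1 : EqOn (gDeriv g T v) v₁ (Icc 0 T) := (hv.memBC_succ hg h1).2
  have hd2 : EqOn (gDeriv g T v₁) (fun t => f t + ((-P) * v₁ t + (-Q) * v t)) (Icc 0 T) :=
    (hv₁.memBC_succ hg ((hf.mono (Nat.zero_le _)).add hg
      ((hv₁0.const_mul hg (-P)).add hg (hv0.const_mul hg (-Q))))).2
  refine ⟨h2, h2.mono (by omega), fun t ht => ?_, hzero hv, ?_⟩
  · change gDeriv g T (gDeriv g T v) t + P * gDeriv g T v t + Q * v t = f t
    rw [hg.gDeriv_congr hd1 ht, hd2 ht, hd1 ht]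
    ring
  · change gDeriv g T v 0 = v₀
    rw [hd1 ⟨le_rfl, hg.pos.le⟩, hzero hv₁]

end Spaces

/-! ### Uniform bounds for coefficients with finitely many large jumps. -/

namespace Derivator

variable {g : Derivator} {T : ℝ}

theorem measurable_jump (g : Derivator) : Measurable g.jump :=
  g.mono.rightLim.measurable.sub g.mono.measurable

theorem measurableSet_D (g : Derivator) : MeasurableSet g.D :=
  measurableSet_lt measurable_const g.measurable_jump

theorem setIntegral_Iio_measureOn {t : ℝ} (ht : t ∈ Icc 0 T) (φ : ℝ → ℂ) :
    ∫ s in Iio t, φ s ∂g.measureOn T = ∫ s in Ico 0 t, φ s ∂g.measure := by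
  rw [measureOn_restrict_Iio ht]

/-- The measure is finite on `[0, T)`, so only finitely many jumps are at least `c`; a bound at the
small jumps is enough. -/
theorem exists_bound_of_jump_lt {ψ : ℝ → ℂ} {K c : ℝ} (hc : 0 < c)
    (h : ∀ s ∈ Ico 0 T, g.jump s < c → ‖ψ s‖ ≤ K) : ∃ M : ℝ, ∀ s ∈ Ico 0 T, ‖ψ s‖ ≤ M := by
  have hfin : {s | ENNReal.ofReal c ≤ g.measureOn T {s}}.Finite :=
    Measure.finite_const_le_meas_of_disjoint_iUnion (g.measureOn T) (ENNReal.ofReal_pos.2 hc)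
      (As := fun s : ℝ => {s}) (fun s => measurableSet_singleton s)
      (fun s t hst => by simpa [Function.onFun] using hst) (measure_ne_top _ _)
  obtain ⟨M, hM⟩ := (hfin.image fun s => ‖ψ s‖).bddAbove
  refine ⟨max K M, fun s hs => ?_⟩
  rcases lt_or_ge (g.jump s) c with h1 | h1
  · exact (h s hs h1).trans (le_max_left _ _)
  · refine (hM (mem_image_of_mem _ ?_)).trans (le_max_right _ _)
    change ENNReal.ofReal c ≤ g.measureOn T {s}
    rw [← ENNReal.ofReal_toReal (measure_ne_top (g.measureOn T) {s}), ← measureReal_def,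
      measureOn_real_singleton hs]
    exact ENNReal.ofReal_le_ofReal h1

theorem exists_bound_inv (g : Derivator) (T : ℝ) (l : ℂ) :
    ∃ M : ℝ, ∀ s ∈ Ico 0 T, ‖(1 + l * g.jump s)⁻¹‖ ≤ M := by
  -- Below this threshold `‖lΔ⁺g‖ ≤ 1/2`, hence `‖1 + lΔ⁺g‖ ≥ 1/2`. A zero denominator can occur
  -- only at a large jump.
  refine exists_bound_of_jump_lt (g := g) (c := 1 / (2 * (‖l‖ + 1))) (K := 2) (by positivity) ?_
  intro s _ hs
  rw [lt_div_iff₀ (by positivity)] at hs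
  have hj := g.jump_nonneg s
  have h1 : ‖l * g.jump s‖ ≤ 1 / 2 := by
    rw [norm_mul, Complex.norm_real, Real.norm_of_nonneg hj]
    nlinarith
  have h2 : 1 / 2 ≤ ‖1 + l * g.jump s‖ := by
    have := norm_sub_le_norm_add (1 : ℂ) (l * g.jump s)
    rw [norm_one] at this
    linarith
  rw [norm_inv]
  exact (inv_anti₀ (by norm_num) h2).trans (by norm_num)

theorem measurable_inv (g : Derivator) (l : ℂ) : Measurable fun s => (1 + l * g.jump s)⁻¹ :=
  ((Complex.measurable_ofReal.comp g.measurable_jump).const_mul l |>.const_add 1).inv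

theorem integrable_inv_mul (l : ℂ) {φ : ℝ → ℂ} (hφ : Integrable φ (g.measureOn T)) :
    Integrable (fun s => (1 + l * g.jump s)⁻¹ * φ s) (g.measureOn T) := by
  obtain ⟨M, hM⟩ := g.exists_bound_inv T l
  exact hφ.bdd_mul (c := M) (g.measurable_inv l).aestronglyMeasurable
    (ae_mem_Ico.mono fun s hs => hM s hs)

theorem integrable_inv (l : ℂ) :
    Integrable (fun s => (1 + l * g.jump s)⁻¹) (g.measureOn T) := by
  simpa using integrable_inv_mul (g := g) (T := T) l (integrable_const (1 : ℂ))

end Derivator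

open Derivator

/-! ### The `g`-exponential and variation of constants. -/

section Exponential

variable {g : Derivator} {T : ℝ} {β : ℝ → ℂ}

theorem integrable_gTilde (hβ : Measurable β) {K : ℝ} (hK : ∀ s ∈ Ico 0 T, ‖β s‖ ≤ K) :
    Integrable (gTilde g β) (g.measureOn T) := by
  have hm : Measurable (gTilde g β) := by
    have hj := Complex.measurable_ofReal.comp g.measurable_jump
    exact Measurable.ite g.measurableSet_D
      ((Complex.measurable_log.comp ((hβ.mul hj).const_add 1)).div hj) hβ
  have hb : ∃ M : ℝ, ∀ s ∈ Ico 0 T, ‖gTilde g β s‖ ≤ M := by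
    -- The threshold makes `‖βΔ⁺g‖ ≤ 1/2`, where the logarithm of `1 + z` is at most `(3/2)‖z‖`;
    -- division by the jump leaves a multiple of `|K|`.
    refine exists_bound_of_jump_lt (g := g) (c := 1 / (2 * (|K| + 1))) (K := 2 * |K|)
      (by positivity) ?_
    intro s hs hsj
    have hβs := (hK s hs).trans (le_abs_self K)
    by_cases hD : s ∈ g.D
    · have hj : 0 < g.jump s := hD
      rw [lt_div_iff₀ (by positivity)] at hsj
      have h1 : ‖β s * g.jump s‖ ≤ |K| * g.jump s := by
        rw [norm_mul, Complex.norm_real, Real.norm_of_nonneg hj.le]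
        gcongr
      have h2 := Complex.norm_log_one_add_half_le_self (z := β s * g.jump s)
        (h1.trans (by nlinarith))
      rw [gTilde, if_pos hD, norm_div, Complex.norm_real, Real.norm_of_nonneg hj.le,
        div_le_iff₀ hj]
      nlinarith [abs_nonneg K]
    · rw [gTilde, if_neg hD]
      linarith [abs_nonneg K]
  obtain ⟨M, hM⟩ := hb
  exact (integrable_const M).mono' hm.aestronglyMeasurable (ae_mem_Ico.mono fun s hs => hM s hs)

theorem exp_gTilde_mul_jump {s : ℝ} (h : 1 + β s * g.jump s ≠ 0) :
    Complex.exp (gTilde g β s * g.jump s) = 1 + β s * g.jump s := by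
  by_cases hD : s ∈ g.D
  · have hj : (g.jump s : ℂ) ≠ 0 := Complex.ofReal_ne_zero.2 (ne_of_gt hD)
    rw [gTilde, if_pos hD, div_mul_cancel₀ _ hj, Complex.exp_log h]
  · simp [g.jump_eq_zero hD]

theorem gTilde_of_jump_eq_zero {s : ℝ} (h : g.jump s = 0) : gTilde g β s = β s := by
  rw [gTilde, if_neg]
  exact fun hD => (ne_of_gt hD) h

theorem isPrimitive_integral_gTilde (hi : Integrable (gTilde g β) (g.measureOn T)) :
    IsPrimitive (g.measureOn T) (Icc 0 T) 0
      (fun t => ∫ s in Ico 0 t, gTilde g β s ∂g.measure) (gTilde g β) :=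
  ⟨hi, fun t ht => by rw [zero_add, setIntegral_Iio_measureOn ht]⟩

theorem isPrimitive_gExp (hi : Integrable (gTilde g β) (g.measureOn T))
    (hβ : ∀ s ∈ Ico 0 T, 1 + β s * g.jump s ≠ 0) :
    IsPrimitive (g.measureOn T) (Icc 0 T) 1 (gExp g β) (fun s => gExp g β s * β s) := by
  refine (isPrimitive_integral_gTilde hi).cexp ae_mem_Icc ?_ ?_
  · filter_upwards [ae_mem_Ico] with s hs
    rw [measureOn_real_singleton hs, exp_gTilde_mul_jump (hβ s hs)]
    ring
  · filter_upwards [ae_mem_Ico] with s hs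
    rw [measureOn_real_singleton hs]
    exact fun h => (gTilde_of_jump_eq_zero h).symm

/-- The exponent `-gTilde` has jump factor `1/(1 + βΔ⁺g)`, and `1/(1 + βΔ⁺g) - 1` is the new
coefficient times `Δ⁺g`. -/
theorem isPrimitive_gExp_inv (hi : Integrable (gTilde g β) (g.measureOn T))
    (hβ : ∀ s ∈ Ico 0 T, 1 + β s * g.jump s ≠ 0) :
    IsPrimitive (g.measureOn T) (Icc 0 T) 1 (fun s => (gExp g β s)⁻¹)
      (fun s => (gExp g β s)⁻¹ * (-β s / (1 + β s * g.jump s))) := by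
  have h1 := (isPrimitive_integral_gTilde hi).const_mul (-1)
  rw [mul_zero] at h1
  have h2 := h1.cexp (β := fun s => -β s / (1 + β s * g.jump s)) ae_mem_Icc ?_ ?_
  · have h3 : ∀ t, Complex.exp (-1 * ∫ s in Ico 0 t, gTilde g β s ∂g.measure) =
        (gExp g β t)⁻¹ := fun t => by rw [neg_one_mul, Complex.exp_neg, gExp]
    simpa only [h3] using h2
  · filter_upwards [ae_mem_Ico] with s hs
    have hne := hβ s hs
    rw [measureOn_real_singleton hs, neg_one_mul, neg_mul, Complex.exp_neg,
      exp_gTilde_mul_jump hne]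
    field_simp
    ring
  · filter_upwards [ae_mem_Ico] with s hs
    rw [measureOn_real_singleton hs]
    intro h
    rw [gTilde_of_jump_eq_zero h, h]
    simp

theorem integrable_gTilde_const (l : ℂ) : Integrable (gTilde g fun _ => l) (g.measureOn T) :=
  integrable_gTilde measurable_const fun _ _ => le_rfl

theorem gExpConst_ne_zero (l : ℂ) (t : ℝ) : gExpConst g l t ≠ 0 := Complex.exp_ne_zero _

variable {l l₁ l₂ : ℂ}

theorem isPrimitive_gExpConst (hl : ∀ s ∈ Ico 0 T, 1 + l * g.jump s ≠ 0) :
    IsPrimitive (g.measureOn T) (Icc 0 T) 1 (gExpConst g l) (fun s => gExpConst g l s * l) :=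
  isPrimitive_gExp (integrable_gTilde_const l) hl

theorem isPrimitive_gExpConst_inv (hl : ∀ s ∈ Ico 0 T, 1 + l * g.jump s ≠ 0) :
    IsPrimitive (g.measureOn T) (Icc 0 T) 1 (fun s => (gExpConst g l s)⁻¹)
      (fun s => (gExpConst g l s)⁻¹ * (-l / (1 + l * g.jump s))) :=
  isPrimitive_gExp_inv (integrable_gTilde_const l) hl

theorem integrable_gWeight_mul (hl : ∀ s ∈ Ico 0 T, 1 + l * g.jump s ≠ 0) {φ : ℝ → ℂ}
    (hφ : Integrable φ (g.measureOn T)) :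
    Integrable (fun s => gWeight g l s * φ s) (g.measureOn T) := by
  refine ((isPrimitive_gExpConst_inv hl).integrable_mul ae_mem_Icc
    (integrable_inv_mul l hφ)).congr (ae_of_all _ fun s => ?_)
  simp only [gWeight]
  ring

/-- Variation of constants: necessity. -/
theorem IsPrimitive.gExpConst_inv_mul (hl : ∀ s ∈ Ico 0 T, 1 + l * g.jump s ≠ 0)
    {c : ℂ} {y φ : ℝ → ℂ}
    (h : IsPrimitive (g.measureOn T) (Icc 0 T) c y fun s => l * y s + φ s) :
    IsPrimitive (g.measureOn T) (Icc 0 T) c (fun s => (gExpConst g l s)⁻¹ * y s)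
      (fun s => gWeight g l s * φ s) := by
  have h1 := (isPrimitive_gExpConst_inv hl).mul h ae_mem_Icc
  rw [one_mul] at h1
  refine h1.congr_deriv ?_
  filter_upwards [ae_mem_Ico] with s hs
  have hne := hl s hs
  have hE := gExpConst_ne_zero (g := g) l s
  rw [measureOn_real_singleton hs, gWeight]
  field_simp
  ring

/-- Variation of constants: sufficiency. -/
theorem IsPrimitive.gExpConst_mul (hl : ∀ s ∈ Ico 0 T, 1 + l * g.jump s ≠ 0)
    {c : ℂ} {Y φ : ℝ → ℂ}
    (h : IsPrimitive (g.measureOn T) (Icc 0 T) c Y fun s => gWeight g l s * φ s) :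
    IsPrimitive (g.measureOn T) (Icc 0 T) c (fun s => gExpConst g l s * Y s)
      (fun s => l * (gExpConst g l s * Y s) + φ s) := by
  have h1 := (isPrimitive_gExpConst hl).mul h ae_mem_Icc
  rw [one_mul] at h1
  refine h1.congr_deriv ?_
  filter_upwards [ae_mem_Ico] with s hs
  have hne := hl s hs
  have hE := gExpConst_ne_zero (g := g) l s
  rw [measureOn_real_singleton hs, gWeight]
  field_simp
  ring

/-- `E₁` solves `y' = l₂ y + (l₁ - l₂) E₁`, so variation of constants for `l₂` applies to it. -/
theorem isPrimitive_gExpConst_ratio (hl₁ : ∀ s ∈ Ico 0 T, 1 + l₁ * g.jump s ≠ 0)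
    (hl₂ : ∀ s ∈ Ico 0 T, 1 + l₂ * g.jump s ≠ 0) :
    IsPrimitive (g.measureOn T) (Icc 0 T) 1 (fun s => (gExpConst g l₂ s)⁻¹ * gExpConst g l₁ s)
      (fun s => (l₁ - l₂) * (gWeight g l₂ s * gExpConst g l₁ s)) := by
  have h : IsPrimitive (g.measureOn T) (Icc 0 T) 1 (gExpConst g l₁)
      fun s => l₂ * gExpConst g l₁ s + (l₁ - l₂) * gExpConst g l₁ s :=
    (isPrimitive_gExpConst hl₁).congr_deriv (ae_of_all _ fun s => by ring)
  exact (h.gExpConst_inv_mul hl₂).congr_deriv (ae_of_all _ fun s => by ring)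

theorem integrable_gWeight_mul_gExpConst (hl₁ : ∀ s ∈ Ico 0 T, 1 + l₁ * g.jump s ≠ 0)
    (hl₂ : ∀ s ∈ Ico 0 T, 1 + l₂ * g.jump s ≠ 0) :
    Integrable (fun s => gWeight g l₂ s * gExpConst g l₁ s) (g.measureOn T) :=
  integrable_gWeight_mul hl₂ ((isPrimitive_gExpConst hl₁).integrable_self ae_mem_Icc)

/-- Principal logarithms add only up to multiples of `2πi`, so the exponents cannot be compared
directly. The combined exponent has jump factor `1` at every atom and vanishes off the atoms, so by
the chain rule its exponential is a primitive of `0`. -/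
theorem gExp_sub_div_eq (hl₁ : ∀ s ∈ Ico 0 T, 1 + l₁ * g.jump s ≠ 0)
    (hl₂ : ∀ s ∈ Ico 0 T, 1 + l₂ * g.jump s ≠ 0) {t : ℝ} (ht : t ∈ Icc 0 T) :
    gExp g (fun u => (l₁ - l₂) / (1 + l₂ * g.jump u)) t =
      gExpConst g l₁ t * (gExpConst g l₂ t)⁻¹ := by
  set β : ℝ → ℂ := fun u => (l₁ - l₂) / (1 + l₂ * g.jump u) with hβ
  obtain ⟨M, hM⟩ := g.exists_bound_inv T l₂
  have hi : Integrable (gTilde g β) (g.measureOn T) := by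
    refine integrable_gTilde ((g.measurable_inv l₂).const_mul (l₁ - l₂)) (K := ‖l₁ - l₂‖ * M) ?_
    intro s hs
    rw [hβ]
    simp only
    rw [div_eq_mul_inv, norm_mul]
    exact mul_le_mul_of_nonneg_left (hM s hs) (norm_nonneg _)
  have hval : ∀ s ∈ Ico 0 T, 1 + β s * g.jump s = (1 + l₁ * g.jump s) / (1 + l₂ * g.jump s) := by
    intro s hs
    have := hl₂ s hs
    rw [hβ]
    field_simp
    ring
  have h := ((isPrimitive_integral_gTilde hi).add
    ((isPrimitive_integral_gTilde (integrable_gTilde_const l₁)).const_mul (-1))).add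
    (isPrimitive_integral_gTilde (integrable_gTilde_const l₂))
  rw [mul_zero, add_zero, add_zero] at h
  have h1 := (h.cexp (β := fun _ => 0) ae_mem_Icc ?_ ?_).eq t ht
  · simp only [mul_zero, integral_zero, add_zero, neg_one_mul, Complex.exp_add,
      Complex.exp_neg] at h1
    change gExp g β t * (gExpConst g l₁ t)⁻¹ * gExpConst g l₂ t = 1 at h1
    have hE1 := gExpConst_ne_zero (g := g) l₁ t
    have hE2 := gExpConst_ne_zero (g := g) l₂ t
    field_simp at h1 ⊢
    exact h1
  · filter_upwards [ae_mem_Ico] with s hs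
    have h1 := hl₁ s hs
    have h2 := hl₂ s hs
    have h3 : 1 + β s * g.jump s ≠ 0 := by
      rw [hval s hs]
      exact div_ne_zero h1 h2
    rw [measureOn_real_singleton hs, add_mul, add_mul, neg_one_mul, neg_mul, Complex.exp_add,
      Complex.exp_add, Complex.exp_neg, exp_gTilde_mul_jump h3, exp_gTilde_mul_jump h1,
      exp_gTilde_mul_jump h2, hval s hs, zero_mul, eq_comm, sub_eq_zero,
      div_mul_eq_mul_div, mul_inv_cancel₀ h1, one_div, inv_mul_cancel₀ h2]
  · filter_upwards [ae_mem_Ico] with s hs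
    rw [measureOn_real_singleton hs]
    intro h
    rw [gTilde_of_jump_eq_zero h, gTilde_of_jump_eq_zero h, gTilde_of_jump_eq_zero h, hβ]
    simp only [h, Complex.ofReal_zero, mul_zero, add_zero, div_one]
    ring

end Exponential

/-! ### The Green's function and its closed forms. -/

section Green

variable {g : Derivator} {T : ℝ} {l₁ l₂ : ℂ} {F : ℝ → ℂ}

theorem gGreen_eq (hl₁ : ∀ s ∈ Ico 0 T, 1 + l₁ * g.jump s ≠ 0)
    (hl₂ : ∀ s ∈ Ico 0 T, 1 + l₂ * g.jump s ≠ 0) {t r : ℝ} (ht : t ∈ Icc 0 T)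
    (hr : r ∈ Ico 0 t) :
    gGreen g l₁ l₂ t r = gExpConst g l₂ t * gWeight g l₁ r *
      ∫ s in Ioo r t, gWeight g l₂ s * gExpConst g l₁ s ∂g.measureOn T := by
  have h : ∫ s in Ioo r t, (1 + l₂ * g.jump s)⁻¹ *
      gExp g (fun u => (l₁ - l₂) / (1 + l₂ * g.jump u)) s ∂g.measure =
      ∫ s in Ioo r t, gWeight g l₂ s * gExpConst g l₁ s ∂g.measureOn T := by
    rw [measureOn_restrict_Ioo hr.1 ht.2]
    refine setIntegral_congr_fun measurableSet_Ioo fun s hs => ?_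
    rw [gExp_sub_div_eq hl₁ hl₂ ⟨hr.1.trans hs.1.le, hs.2.le.trans ht.2⟩, gWeight]
    ring
  rw [gGreen, h, indicator_of_mem hr, gWeight]
  ring

theorem gGreen_eq_zero {t r : ℝ} (hr : r ∉ Ico 0 t) : gGreen g l₁ l₂ t r = 0 := by
  rw [gGreen, indicator_of_notMem hr]
  ring

theorem gGreen_mul_ae_eq (hl₁ : ∀ s ∈ Ico 0 T, 1 + l₁ * g.jump s ≠ 0)
    (hl₂ : ∀ s ∈ Ico 0 T, 1 + l₂ * g.jump s ≠ 0) {t : ℝ} (ht : t ∈ Icc 0 T) :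
    (fun r => gExpConst g l₂ t * (gWeight g l₁ r * F r *
      ∫ s in Ioo r t, gWeight g l₂ s * gExpConst g l₁ s ∂g.measureOn T)) =ᵐ[g.measureOn T]
      fun r => gGreen g l₁ l₂ t r * F r := by
  filter_upwards [ae_mem_Ico] with r hr
  by_cases hrt : r < t
  · rw [gGreen_eq hl₁ hl₂ ht ⟨hr.1, hrt⟩]
    ring
  · rw [gGreen_eq_zero fun h => hrt h.2, Ioo_eq_empty hrt]
    simp

theorem integrable_gGreen_mul (hl₁ : ∀ s ∈ Ico 0 T, 1 + l₁ * g.jump s ≠ 0)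
    (hl₂ : ∀ s ∈ Ico 0 T, 1 + l₂ * g.jump s ≠ 0) (hF : Integrable F (g.measureOn T))
    {t : ℝ} (ht : t ∈ Icc 0 T) : Integrable (fun r => gGreen g l₁ l₂ t r * F r) g.measure := by
  have h : IntegrableOn (fun r => gGreen g l₁ l₂ t r * F r) (Ico 0 T) g.measure :=
    ((integrable_mul_setIntegral_Ioo t (integrable_gWeight_mul hl₁ hF)
      (integrable_gWeight_mul_gExpConst hl₁ hl₂)).const_mul _).congr
      (gGreen_mul_ae_eq hl₁ hl₂ ht)
  refine (integrableOn_iff_integrable_of_support_subset fun r hr => ?_).1 h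
  by_contra hr'
  refine hr ?_
  simp only
  rw [gGreen_eq_zero fun h => hr' ⟨h.1, h.2.trans_le ht.2⟩, zero_mul]

theorem integral_gGreen_mul (hl₁ : ∀ s ∈ Ico 0 T, 1 + l₁ * g.jump s ≠ 0)
    (hl₂ : ∀ s ∈ Ico 0 T, 1 + l₂ * g.jump s ≠ 0) (hF : Integrable F (g.measureOn T))
    {t : ℝ} (ht : t ∈ Icc 0 T) :
    ∫ r, gGreen g l₁ l₂ t r * F r ∂g.measure = forcedPart g l₁ l₂ F t := by
  rw [← setIntegral_eq_integral_of_forall_compl_eq_zero (s := Ico 0 T)]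
  · change ∫ r, gGreen g l₁ l₂ t r * F r ∂g.measureOn T = _
    rw [← integral_congr_ae (gGreen_mul_ae_eq hl₁ hl₂ ht), integral_const_mul,
      integral_mul_setIntegral_Ioo t (integrable_gWeight_mul hl₁ hF)
        (integrable_gWeight_mul_gExpConst hl₁ hl₂), forcedPart, setIntegral_Iio_measureOn ht]
    congr 1
    refine setIntegral_congr_fun measurableSet_Ico fun s hs => ?_
    rw [setIntegral_Iio_measureOn ⟨hs.1, hs.2.le.trans ht.2⟩]
  · intro r hr
    rw [gGreen_eq_zero fun h => hr ⟨h.1, h.2.trans_le ht.2⟩, zero_mul]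

theorem gGreen_of_ne (hl₁ : ∀ s ∈ Ico 0 T, 1 + l₁ * g.jump s ≠ 0)
    (hl₂ : ∀ s ∈ Ico 0 T, 1 + l₂ * g.jump s ≠ 0) (hne : l₁ ≠ l₂) {t : ℝ} (ht : t ∈ Icc 0 T)
    (r : ℝ) : gGreen g l₁ l₂ t r = (Ico 0 t).indicator (fun r => (l₁ - l₂)⁻¹ *
      (gExpConst g l₁ t * gWeight g l₁ r - gExpConst g l₂ t * gWeight g l₂ r)) r := by
  by_cases hr : r ∈ Ico 0 t
  · have hrT : r ∈ Ico 0 T := ⟨hr.1, hr.2.trans_le ht.2⟩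
    rw [gGreen_eq hl₁ hl₂ ht hr, indicator_of_mem hr]
    have h := isPrimitive_gExpConst_ratio hl₁ hl₂
    have ht' := h.eq t ht
    -- Splitting the primitive formula for `E₁ / E₂` at `r` expresses the integral over `(r, t)` by
    -- the values at `t` and `r` and the atom at `r`.
    rw [setIntegral_Iio_split h.integrable hr.2, ← add_assoc, ← add_assoc,
      ← h.eq r (Ico_subset_Icc_self hrT), integral_const_mul,
      measureOn_real_singleton hrT] at ht'
    have hsub : l₁ - l₂ ≠ 0 := sub_ne_zero.2 hne
    have h1 := hl₁ r hrT
    have h2 := hl₂ r hrT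
    have hE1 := gExpConst_ne_zero (g := g) l₁ t
    have hE2 := gExpConst_ne_zero (g := g) l₂ t
    have hE3 := gExpConst_ne_zero (g := g) l₁ r
    have hE4 := gExpConst_ne_zero (g := g) l₂ r
    have hI : ∫ s in Ioo r t, gWeight g l₂ s * gExpConst g l₁ s ∂g.measureOn T =
        (l₁ - l₂)⁻¹ * ((gExpConst g l₂ t)⁻¹ * gExpConst g l₁ t -
          (gExpConst g l₂ r)⁻¹ * gExpConst g l₁ r -
          (l₁ - l₂) * (gWeight g l₂ r * gExpConst g l₁ r) * g.jump r) := by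
      rw [eq_inv_mul_iff_mul_eq₀ hsub]
      linear_combination -ht'
    have h2' : 1 + (g.jump r : ℂ) * l₂ ≠ 0 := mul_comm l₂ (g.jump r : ℂ) ▸ h2
    have h1' : 1 + (g.jump r : ℂ) * l₁ ≠ 0 := mul_comm l₁ (g.jump r : ℂ) ▸ h1
    rw [hI, gWeight, gWeight]
    field_simp
    ring
  · rw [gGreen_eq_zero hr, indicator_of_notMem hr]

theorem gGreen_self (hl₁ : ∀ s ∈ Ico 0 T, 1 + l₁ * g.jump s ≠ 0) {t : ℝ} (ht : t ∈ Icc 0 T)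
    (r : ℝ) : gGreen g l₁ l₁ t r = (Ico 0 t).indicator (fun r => gExpConst g l₁ t * gWeight g l₁ r *
      ((∫ s in Ico 0 t, (1 + l₁ * g.jump s)⁻¹ ∂g.measure) -
        (∫ s in Ico 0 r, (1 + l₁ * g.jump s)⁻¹ ∂g.measure) -
        g.jump r / (1 + l₁ * g.jump r))) r := by
  by_cases hr : r ∈ Ico 0 t
  · have hrT : r ∈ Ico 0 T := ⟨hr.1, hr.2.trans_le ht.2⟩
    have hw : ∀ s, gWeight g l₁ s * gExpConst g l₁ s = (1 + l₁ * g.jump s)⁻¹ := by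
      intro s
      rw [gWeight, div_mul_eq_mul_div, inv_mul_cancel₀ (gExpConst_ne_zero l₁ s), one_div]
    have h := setIntegral_Iio_split (integrable_inv (g := g) (T := T) l₁) hr.2
    rw [gGreen_eq hl₁ hl₁ ht hr, indicator_of_mem hr, ← setIntegral_Iio_measureOn ht,
      ← setIntegral_Iio_measureOn (Ico_subset_Icc_self hrT), h, measureOn_real_singleton hrT]
    simp only [hw]
    ring
  · rw [gGreen_eq_zero hr, indicator_of_notMem hr]

end Green

/-! ### Passing between `𝕜` and `ℂ`. -/

section Scalars

variable {𝕜 : Type*} [RCLike 𝕜]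

/-- The inclusion of `𝕜` in `ℂ` as a continuous real-linear map. -/
noncomputable def toCL : 𝕜 →L[ℝ] ℂ :=
  RCLike.reCLM.smulRight (1 : ℂ) + RCLike.imCLM.smulRight Complex.I

/-- The real-linear retraction of `ℂ` onto `𝕜`: the identity for `𝕜 = ℂ`, the real part for
`𝕜 = ℝ`. -/
noncomputable def fromCL : ℂ →L[ℝ] 𝕜 :=
  Complex.reCLM.smulRight (1 : 𝕜) + Complex.imCLM.smulRight (RCLike.I : 𝕜)

theorem toCL_apply (z : 𝕜) : toCL z = toC z := by
  apply Complex.ext <;> simp [toCL, toC]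

theorem fromCL_apply (z : ℂ) : (fromCL z : 𝕜) = (z.re : 𝕜) + (z.im : 𝕜) * RCLike.I := by
  simp [fromCL, RCLike.real_smul_eq_coe_mul]

theorem toC_mul (a b : 𝕜) : toC (a * b) = toC a * toC b := by
  apply Complex.ext <;> simp [toC, RCLike.mul_re, RCLike.mul_im]

theorem toC_ofReal (r : ℝ) : toC (r : 𝕜) = r := by
  apply Complex.ext <;> simp [toC]

theorem toC_add (a b : 𝕜) : toC (a + b) = toC a + toC b := by
  simp only [← toCL_apply, map_add]

theorem toC_injective : Function.Injective (toC : 𝕜 → ℂ) := by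
  intro a b h
  have h1 := congrArg Complex.re h
  have h2 := congrArg Complex.im h
  exact RCLike.ext h1 h2

theorem fromCL_toC (z : 𝕜) : fromCL (toC z) = z := by
  rw [fromCL_apply, toC]
  exact RCLike.re_add_im z

/-- Either `I` squares to `-1` in `𝕜`, or `I = 0` and `p` has no imaginary part. This carries an
equation with coefficients in `𝕜` through the projection. -/
theorem fromCL_mul (p : 𝕜) (z : ℂ) : fromCL (toC p * z) = p * fromCL z := by
  have h : RCLike.im p = 0 ∨ (RCLike.I : 𝕜) * RCLike.I = -1 := by
    rcases RCLike.I_mul_I (K := 𝕜) with h | h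
    · refine Or.inl ?_
      have := RCLike.mul_im_I_ax p
      rw [h] at this
      simpa using this.symm
    · exact Or.inr h
  rw [fromCL_apply, fromCL_apply]
  nth_rewrite 3 [← RCLike.re_add_im p]
  rcases h with h | h
  · simp [toC, h]
    ring
  · simp only [toC, Complex.mul_re, Complex.mul_im, RCLike.ofReal_sub, RCLike.ofReal_add,
      RCLike.ofReal_mul]
    linear_combination (-(RCLike.im p : 𝕜) * (z.im : 𝕜)) * h

end Scalars

/-! ### Uniqueness, existence and the main theorem. -/

section Solution

variable {𝕜 : Type*} [RCLike 𝕜] {g : Derivator} {T : ℝ}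

/-- The assumption concerns roots in `𝕜` only, but `1 + lΔ⁺g = 0` forces `l = -1/Δ⁺g`, which is real
and so comes from `𝕜`. -/
theorem one_add_mul_jump_ne_zero {P Q : 𝕜}
    (hroot : ∀ l : 𝕜, l ^ 2 + P * l + Q = 0 →
      ∀ t ∈ Ico 0 T ∩ g.D, 1 + l * ((g.jump t : ℝ) : 𝕜) ≠ 0)
    {l : ℂ} (hl : l ^ 2 + toC P * l + toC Q = 0) :
    ∀ s ∈ Ico 0 T, 1 + l * g.jump s ≠ 0 := by
  intro s hs h
  by_cases hD : s ∈ g.D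
  · have hj : g.jump s ≠ 0 := ne_of_gt hD
    have hjC : (g.jump s : ℂ) ≠ 0 := Complex.ofReal_ne_zero.2 hj
    have hjK : ((g.jump s : ℝ) : 𝕜) ≠ 0 := RCLike.ofReal_ne_zero.2 hj
    have hl' : l = toC (((-(g.jump s)⁻¹ : ℝ)) : 𝕜) := by
      rw [toC_ofReal]
      push_cast
      field_simp
      linear_combination h
    refine hroot ((-(g.jump s)⁻¹ : ℝ) : 𝕜) (toC_injective ?_) s ⟨hs, hD⟩ ?_
    · have h0 : toC (0 : 𝕜) = 0 := by rw [← toCL_apply, map_zero]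
      rw [toC_add, toC_add, toC_mul, pow_two, toC_mul, ← hl', h0, ← pow_two, hl]
    · push_cast
      field_simp
      ring
  · rw [g.jump_eq_zero hD] at h
    simp at h

variable {l₁ l₂ : ℂ}

/-- The explicit formula for the solutions. -/
theorem IsSolution.toC_eq (hg : g.Admissible T) {P Q x₀ v₀ : 𝕜} {f w : ℝ → 𝕜}
    (hP : toC P = -(l₁ + l₂)) (hQ : toC Q = l₁ * l₂)
    (hl₁ : ∀ s ∈ Ico 0 T, 1 + l₁ * g.jump s ≠ 0) (hl₂ : ∀ s ∈ Ico 0 T, 1 + l₂ * g.jump s ≠ 0)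
    (hf : Integrable f (g.measureOn T)) (hw : IsSolution g T P Q f x₀ v₀ w) {t : ℝ}
    (ht : t ∈ Icc 0 T) : toC (w t) =
      homPart g l₁ l₂ (toC x₀) (toC v₀) t + forcedPart g l₁ l₂ (fun r => toC (f r)) t := by
  obtain ⟨hw2, heq, hw0, hw1⟩ := hw
  have hw1' : gDeriv g T w 0 = v₀ := hw1
  have hp := ((hw2.mono one_le_two).isPrimitive hg).clm_comp toCL
  have hp1 := ((memBC_succ.1 hw2).2.2.isPrimitive hg).clm_comp toCL
  simp only [toCL_apply, hw0, hw1'] at hp hp1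
  have hF : Integrable (fun r => toC (f r)) (g.measureOn T) := by
    simpa only [toCL_apply] using (toCL : 𝕜 →L[ℝ] ℂ).integrable_comp hf
  set z : ℝ → ℂ := fun t => toC (w t) with hz
  set z₁ : ℝ → ℂ := fun t => toC (gDeriv g T w t) with hz₁
  -- First factor: `y = w' - l₂ w` solves `y' = l₁ y + f`.
  have hy : IsPrimitive (g.measureOn T) (Icc 0 T) (toC v₀ + (-l₂) * toC x₀)
      (fun t => z₁ t + (-l₂) * z t) (fun t => l₁ * (z₁ t + (-l₂) * z t) + toC (f t)) := by
    refine (hp1.add (hp.const_mul (-l₂))).congr_deriv ?_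
    filter_upwards [ae_mem_Icc] with s hs
    have h1 : toC (gIterDeriv g T 2 w s) + toC P * z₁ s + toC Q * z s = toC (f s) := by
      rw [← heq s hs, toC_add, toC_add, toC_mul, toC_mul]
      rfl
    change toC (gIterDeriv g T 2 w s) + _ = _
    rw [hP, hQ] at h1
    linear_combination h1
  have hY := hy.gExpConst_inv_mul hl₁
  have hyeq : ∀ s ∈ Icc 0 T, z₁ s + (-l₂) * z s = gExpConst g l₁ s * ((toC v₀ + (-l₂) * toC x₀) +
      ∫ r in Ico 0 s, gWeight g l₁ r * toC (f r) ∂g.measure) := by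
    intro s hs
    rw [← setIntegral_Iio_measureOn hs, ← hY.eq s hs,
      mul_inv_cancel_left₀ (gExpConst_ne_zero l₁ s)]
  -- Second factor: `w' = l₂ w + y`, with `y` now known explicitly.
  have hz' : IsPrimitive (g.measureOn T) (Icc 0 T) (toC x₀) z
      (fun t => l₂ * z t + (z₁ t + (-l₂) * z t)) :=
    hp.congr_deriv (ae_of_all _ fun s => by ring)
  have hZ := hz'.gExpConst_inv_mul hl₂
  have hK := integrable_gWeight_mul_gExpConst hl₁ hl₂
  have hKI : Integrable (fun s => gWeight g l₂ s * gExpConst g l₁ s *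
      ∫ r in Iio s, gWeight g l₁ r * toC (f r) ∂g.measureOn T) (g.measureOn T) :=
    (integrable_mul_setIntegral_Iio (integrable_gWeight_mul hl₁ hF) hK).congr
      (ae_of_all _ fun s => mul_comm _ _)
  have hzt : z t = gExpConst g l₂ t * ((gExpConst g l₂ t)⁻¹ * z t) := by
    rw [mul_inv_cancel_left₀ (gExpConst_ne_zero l₂ t)]
  have hint : ∫ s in Iio t, gWeight g l₂ s * (z₁ s + (-l₂) * z s) ∂g.measureOn T =
      (toC v₀ + (-l₂) * toC x₀) *
        (∫ s in Iio t, gWeight g l₂ s * gExpConst g l₁ s ∂g.measureOn T) +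
      ∫ s in Iio t, gWeight g l₂ s * gExpConst g l₁ s *
        (∫ r in Iio s, gWeight g l₁ r * toC (f r) ∂g.measureOn T) ∂g.measureOn T := by
    rw [← integral_const_mul, ← integral_add (hK.const_mul _).integrableOn hKI.integrableOn]
    refine integral_congr_ae (ae_restrict_of_ae ?_)
    filter_upwards [ae_mem_Icc] with s hs
    rw [hyeq s hs, setIntegral_Iio_measureOn hs]
    ring
  have hinner : ∫ s in Iio t, gWeight g l₂ s * gExpConst g l₁ s *
        (∫ r in Iio s, gWeight g l₁ r * toC (f r) ∂g.measureOn T) ∂g.measureOn T =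
      ∫ s in Ico 0 t, gWeight g l₂ s * gExpConst g l₁ s *
        (∫ r in Ico 0 s, gWeight g l₁ r * toC (f r) ∂g.measure) ∂g.measure := by
    rw [setIntegral_Iio_measureOn ht]
    refine setIntegral_congr_fun measurableSet_Ico fun s hs => ?_
    rw [setIntegral_Iio_measureOn ⟨hs.1, hs.2.le.trans ht.2⟩]
  change z t = _
  rw [hzt, hZ.eq t ht, hint, hinner, setIntegral_Iio_measureOn ht, homPart, forcedPart]
  ring

/-- The roots may be non-real when `𝕜 = ℝ`, so `Y` and `V` are built in `ℂ` from the two first-order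
equations. Only the second-order system for `V` and `l₂ V + Y` has coefficients in `𝕜`, and it is
this system that is projected. -/
theorem exists_solution (hg : g.Admissible T) {P Q : 𝕜} (x₀ v₀ : 𝕜) {f : ℝ → 𝕜} {n : ℕ}
    (hP : toC P = -(l₁ + l₂)) (hQ : toC Q = l₁ * l₂)
    (hl₁ : ∀ s ∈ Ico 0 T, 1 + l₁ * g.jump s ≠ 0) (hl₂ : ∀ s ∈ Ico 0 T, 1 + l₂ * g.jump s ≠ 0)
    (hf : MemBC g T n f) :
    ∃ v : ℝ → 𝕜, MemBC g T (n + 2) v ∧ IsSolution g T P Q f x₀ v₀ v := by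
  have hF : Integrable (fun r => toC (f r)) (g.measureOn T) := by
    simpa only [toCL_apply] using (toCL : 𝕜 →L[ℝ] ℂ).integrable_comp hf.integrable
  have hY := (IsPrimitive.of_integrable (integrable_gWeight_mul hl₁ hF) (Icc 0 T)
    (toC v₀ - l₂ * toC x₀)).gExpConst_mul hl₁
  set Y : ℝ → ℂ := fun s => gExpConst g l₁ s * ((toC v₀ - l₂ * toC x₀) +
    ∫ r in Iio s, gWeight g l₁ r * toC (f r) ∂g.measureOn T)
  have hV := (IsPrimitive.of_integrable (integrable_gWeight_mul hl₂
    (hY.integrable_self ae_mem_Icc)) (Icc 0 T) (toC x₀)).gExpConst_mul hl₂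
  set V : ℝ → ℂ := fun s => gExpConst g l₂ s * (toC x₀ +
    ∫ r in Iio s, gWeight g l₂ r * Y r ∂g.measureOn T)
  have hV₁ := (hV.const_mul l₂).add hY
  rw [show l₂ * toC x₀ + (toC v₀ - l₂ * toC x₀) = toC v₀ by ring] at hV₁
  have hv := hV.clm_comp (fromCL : ℂ →L[ℝ] 𝕜)
  have hv₁ := hV₁.clm_comp (fromCL : ℂ →L[ℝ] 𝕜)
  rw [fromCL_toC] at hv hv₁
  refine ⟨_, memBC_of_isPrimitive hg hf hv (hv₁.congr_deriv (ae_of_all _ fun s => ?_))⟩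
  change fromCL (l₂ * (l₂ * V s + Y s) + (l₁ * Y s + toC (f s))) =
    f s + ((-P) * fromCL (l₂ * V s + Y s) + (-Q) * fromCL (V s))
  have hfs := fromCL_toC (f s)
  generalize toC (f s) = a at hfs ⊢
  rw [neg_mul, neg_mul, ← fromCL_mul, ← fromCL_mul, ← map_neg, ← map_neg, ← map_add,
    ← hfs, ← map_add, hP, hQ]
  congr 1
  ring

end Solution

theorem mainTheorem3 {𝕜 : Type*} [RCLike 𝕜] (g : Derivator) (T : ℝ) (hT : 0 < T)
    (hg0 : g 0 = 0) (hgc : ContinuousAt g 0)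
    (h0 : (0 : ℝ) ∉ g.Nminus) (hTend : T ∉ g.Nplus ∪ g.D ∪ g.C)
    (n : ℕ) (P Q x₀ v₀ : 𝕜) (f : ℝ → 𝕜) (hf : MemBC g T n f)
    (hroot : ∀ l : 𝕜, l ^ 2 + P * l + Q = 0 →
      ∀ t ∈ Ico 0 T ∩ g.D, 1 + l * ((g.jump t : ℝ) : 𝕜) ≠ 0) :
    ∃ v : ℝ → 𝕜, MemBC g T (n + 2) v ∧ IsSolution g T P Q f x₀ v₀ v ∧
      (∀ w : ℝ → 𝕜, IsSolution g T P Q f x₀ v₀ w → EqOn w v (Icc 0 T)) ∧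
      ∀ l₁ l₂ : ℂ, (∀ z : ℂ, z ^ 2 + toC P * z + toC Q = (z - l₁) * (z - l₂)) →
        -- the integrands of the explicit formula are integrable
        (IntegrableOn (fun s => gWeight g l₂ s * gExpConst g l₁ s) (Ico 0 T) g.measure ∧
          IntegrableOn (fun r => gWeight g l₁ r * toC (f r)) (Ico 0 T) g.measure ∧
          IntegrableOn (fun s => gWeight g l₂ s * gExpConst g l₁ s *
            ∫ r in Ico 0 s, gWeight g l₁ r * toC (f r) ∂g.measure) (Ico 0 T) g.measure) ∧
        -- the explicit formula
        (∀ t ∈ Icc 0 T, toC (v t) =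
          homPart g l₁ l₂ (toC x₀) (toC v₀) t + forcedPart g l₁ l₂ (fun r => toC (f r)) t) ∧
        -- the representation by the Green's function
        (∀ t ∈ Icc 0 T, Integrable (fun r => gGreen g l₁ l₂ t r * toC (f r)) g.measure ∧
          toC (v t) = homPart g l₁ l₂ (toC x₀) (toC v₀) t +
            ∫ r, gGreen g l₁ l₂ t r * toC (f r) ∂g.measure) ∧
        -- the Green's function for distinct roots
        (l₁ ≠ l₂ → ∀ t ∈ Icc 0 T, ∀ r ∈ Icc 0 T, gGreen g l₁ l₂ t r =
          (Ico 0 t).indicator (fun r => (l₁ - l₂)⁻¹ *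
            (gExpConst g l₁ t * gWeight g l₁ r - gExpConst g l₂ t * gWeight g l₂ r)) r) ∧
        -- the Green's function for a double root
        (l₁ = l₂ → ∀ t ∈ Icc 0 T, ∀ r ∈ Icc 0 T, gGreen g l₁ l₂ t r =
          (Ico 0 t).indicator (fun r => gExpConst g l₁ t * gWeight g l₁ r *
            ((∫ s in Ico 0 t, (1 + l₁ * g.jump s)⁻¹ ∂g.measure) -
              (∫ s in Ico 0 r, (1 + l₁ * g.jump s)⁻¹ ∂g.measure) -
              g.jump r / (1 + l₁ * g.jump r))) r) := by
  have hg : g.Admissible T := ⟨hT, h0, hTend⟩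
  have hl : ∀ l₁ l₂ : ℂ, (∀ z : ℂ, z ^ 2 + toC P * z + toC Q = (z - l₁) * (z - l₂)) →
      toC P = -(l₁ + l₂) ∧ toC Q = l₁ * l₂ ∧ (∀ s ∈ Ico 0 T, 1 + l₁ * g.jump s ≠ 0) ∧
        ∀ s ∈ Ico 0 T, 1 + l₂ * g.jump s ≠ 0 := by
    intro l₁ l₂ h
    have hQ : toC Q = l₁ * l₂ := by linear_combination h 0
    -- Vieta's relations, read off from the factorization at `z = 0` and `z = 1`.
    have hP : toC P = -(l₁ + l₂) := by linear_combination h 1 - h 0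
    exact ⟨hP, hQ, one_add_mul_jump_ne_zero hroot (by rw [h]; ring),
      one_add_mul_jump_ne_zero hroot (by rw [h]; ring)⟩
  -- `d` is a square root of the discriminant. The solution is built from one ordering of the roots;
  -- the formula then holds for any ordering, since it is valid for every solution.
  obtain ⟨d, hd⟩ := IsAlgClosed.exists_pow_nat_eq (toC P ^ 2 - 4 * toC Q) two_pos
  obtain ⟨hP, hQ, ha, hb⟩ := hl ((-toC P + d) / 2) ((-toC P - d) / 2)
    (fun z => by linear_combination hd / 4)
  obtain ⟨v, hv, hsol⟩ := exists_solution hg x₀ v₀ hP hQ ha hb hf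
  refine ⟨v, hv, hsol, fun w hw t ht => toC_injective ?_, fun l₁ l₂ h => ?_⟩
  · rw [hw.toC_eq hg hP hQ ha hb hf.integrable ht, hsol.toC_eq hg hP hQ ha hb hf.integrable ht]
  · obtain ⟨hP, hQ, hl₁, hl₂⟩ := hl l₁ l₂ h
    have hF : Integrable (fun r => toC (f r)) (g.measureOn T) := by
      simpa only [toCL_apply] using (toCL : 𝕜 →L[ℝ] ℂ).integrable_comp hf.integrable
    have hK := integrable_gWeight_mul_gExpConst hl₁ hl₂
    have hW := integrable_gWeight_mul hl₁ hF
    refine ⟨⟨hK, hW, ?_⟩, fun t ht => hsol.toC_eq hg hP hQ hl₁ hl₂ hf.integrable ht,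
      fun t ht => ⟨integrable_gGreen_mul hl₁ hl₂ hF ht, ?_⟩,
      fun hne t ht r _ => gGreen_of_ne hl₁ hl₂ hne ht r, ?_⟩
    · refine (integrable_mul_setIntegral_Iio hW hK).congr ?_
      filter_upwards [ae_mem_Icc] with s hs
      rw [setIntegral_Iio_measureOn hs, mul_comm]
    · rw [integral_gGreen_mul hl₁ hl₂ hF ht]
      exact hsol.toC_eq hg hP hQ hl₁ hl₂ hf.integrable ht
    · rintro rfl t ht r _
      exact gGreen_self hl₁ ht r
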